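/- Let $K$ be a field and let $R=\bigoplus_{i\ge 0}R_i$ be a standard graded $K$-algebra (that is, $R$ is generated as a $K$-algebra by $R_1$ and $\dim_K R_1<\infty$), with maximal homogeneous ideal $\mathfrak m$. For a graded $R$-module $N$ let $\beta^R_{i,j}(N)=\dim_K \operatorname{Tor}^R_i(N,R/\mathfrak m)_j$, let $t^R_i(N)=\sup\{j\in\mathbb Z:\beta^R_{i,j}(N)\ne 0\}$ (equal to $-\infty$ if there is no such $j$), and let $\operatorname{reg}_R(N)=\sup_{i\ge 0}\,(t^R_i(N)-i)$. Assume that $R$ is a Koszul algebra, i.e. $\operatorname{reg}_R(R/\mathfrak m)=0$. Let $M$ be a finitely generated $\mathbb Z$-graded $R$-module and $I\subseteq R$ a homogeneous ideal such that $M/IM$ has Krull dimension $0$ (in particular $M/IM\neq 0$). Then there is a smallest integer $c\ge 0$ such that $\mathfrak m^c\subseteq I+\operatorname{Ann}(M)$ and $I$ is generated in degrees $\le c$. Let $u_1,\dots,u_n$ be a minimal system of homogeneous generators of $I$, let $F$ be the graded free $R$-module with basis $e_1,\dots,e_n$, $\deg e_a=\deg u_a$, let $\phi:F\to R$ be the map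 $e_a\mapsto u_a$ (so $\phi$ has degree $0$, its image is $I$ and $\ker\phi\subseteq\mathfrak mF$), and let $Z_t(I,M)$ and $H_t(I,M)$ be the graded modules of cycles and of homology in homological degree $t$ of the Koszul complex $\bigwedge^\bullet F\otimes_R M$ of $\phi$ with coefficients in $M$. Then, for every $t\ge 0$, $$\operatorname{reg}_R Z_t(I,M)\le t(c+1)+\operatorname{reg}_R M$$ and $$\operatorname{reg}_R H_t(I,M)\le t(c+1)+\operatorname{reg}_R M+c-1 .$$ -/

import Mathlib

open scoped TensorProduct

noncomputable section

namespace KoszulReg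

universe u v w

/-! ### Standard graded algebras

Everything is graded by `ℤ`.  A `K`-algebra generated by its component of degree `1` automatically
has no component of negative degree, and its component of degree `0` is the image of `K`. -/

section Ring

variable {K : Type w} {R : Type u} [Field K] [CommRing R] [Algebra K R]

/-- `R = ⨁ R_i` is a standard graded `K`-algebra: it is generated as a `K`-algebra by `R_1`, and
`R_1` is a finite dimensional `K`-vector space. -/
structure IsStandardGraded (𝒜 : ℤ → Submodule K R) [GradedAlgebra 𝒜] : Prop where
  adjoin_one : Algebra.adjoin K (𝒜 1 : Set R) = ⊤
  finite_one : Module.Finite K (𝒜 1)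

/-- The maximal homogeneous ideal `𝔪`, generated by the homogeneous elements of positive degree. -/
def maxIdeal (𝒜 : ℤ → Submodule K R) : Ideal R :=
  Ideal.span {x | ∃ i : ℤ, 0 < i ∧ x ∈ 𝒜 i}

/-- The ideal `I` is generated by its homogeneous elements of degree `≤ c`. -/
def GeneratedInDegreeLE (𝒜 : ℤ → Submodule K R) (I : Ideal R) (c : ℤ) : Prop :=
  I = Ideal.span {x | x ∈ I ∧ ∃ i : ℤ, i ≤ c ∧ x ∈ 𝒜 i}

/-- The grading of the residue field `R ⧸ 𝔪`, induced by that of `R`. -/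
def residueGrading (𝒜 : ℤ → Submodule K R) (j : ℤ) : Submodule K (R ⧸ maxIdeal 𝒜) :=
  (𝒜 j).map ((maxIdeal 𝒜).mkQ.restrictScalars K)

/-! ### The standard graded free resolution of the residue field

A graded free module is `ι →₀ R` with basis vectors of degrees `deg a`.  The residue field is
resolved by covering, at each step, the kernel of the previous map by the graded free module on all
its homogeneous elements. -/

/-- The component of degree `j` of the graded free module `ι →₀ R`. -/
def freeGrading (𝒜 : ℤ → Submodule K R) {ι : Type u} (deg : ι → ℤ) (j : ℤ) :
    Submodule K (ι →₀ R) where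
  carrier := {f | ∀ a, f a ∈ 𝒜 (j - deg a)}
  add_mem' hf hg a := (𝒜 _).add_mem (hf a) (hg a)
  zero_mem' _ := (𝒜 _).zero_mem
  smul_mem' k _ hf a := (𝒜 _).smul_mem k (hf a)

/-- A stage of the resolution: a graded free module, with the submodule that remains to be
covered. -/
structure Stage (R : Type u) [CommRing R] where
  ι : Type u
  deg : ι → ℤ
  ker : Submodule R (ι →₀ R)

/-- The homogeneous elements (with their degrees) of the submodule to be covered. -/
abbrev Stage.Gen (𝒜 : ℤ → Submodule K R) (s : Stage R) : Type u :=
  {p : ℤ × (s.ι →₀ R) // p.2 ∈ freeGrading 𝒜 s.deg p.1 ∧ p.2 ∈ s.ker}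

/-- The graded map from the free module on the homogeneous elements of `s.ker`. -/
def Stage.cover (𝒜 : ℤ → Submodule K R) (s : Stage R) : (s.Gen 𝒜 →₀ R) →ₗ[R] (s.ι →₀ R) :=
  Finsupp.linearCombination R fun p => p.1.2

/-- The next stage of the resolution. -/
abbrev Stage.next (𝒜 : ℤ → Submodule K R) (s : Stage R) : Stage R where
  ι := s.Gen 𝒜
  deg p := p.1.1
  ker := LinearMap.ker (s.cover 𝒜)

/-- The augmentation `P_0 = R → R ⧸ 𝔪`. -/
def aug (𝒜 : ℤ → Submodule K R) : (PUnit.{u + 1} →₀ R) →ₗ[R] R ⧸ maxIdeal 𝒜 :=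
  (maxIdeal 𝒜).mkQ ∘ₗ Finsupp.lapply PUnit.unit

/-- The stages of the resolution; the first one is `P_0 = R` with basis vector of degree `0`. -/
@[reducible] def stage (𝒜 : ℤ → Submodule K R) : ℕ → Stage R
  | 0 => ⟨PUnit, fun _ => 0, LinearMap.ker (aug 𝒜)⟩
  | n + 1 => (stage 𝒜 n).next 𝒜

/-- The index set of the homogeneous basis of the free module `P_n`. -/
abbrev ResIdx (𝒜 : ℤ → Submodule K R) (n : ℕ) : Type u := (stage 𝒜 n).ι

/-- The degrees of the basis vectors of `P_n`. -/
abbrev resDeg (𝒜 : ℤ → Submodule K R) (n : ℕ) : ResIdx 𝒜 n → ℤ := (stage 𝒜 n).deg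

/-- The differential `P_{n+1} → P_n`. -/
def resD (𝒜 : ℤ → Submodule K R) (n : ℕ) :
    (ResIdx 𝒜 (n + 1) →₀ R) →ₗ[R] (ResIdx 𝒜 n →₀ R) :=
  (stage 𝒜 n).cover 𝒜

/-! The complex just defined is a graded free resolution of `R ⧸ 𝔪`. -/

section Resolution

variable (𝒜 : ℤ → Submodule K R)

theorem resD_single_mem (n : ℕ) (b : ResIdx 𝒜 (n + 1)) :
    resD 𝒜 n (Finsupp.single b 1) ∈ freeGrading 𝒜 (resDeg 𝒜 n) (resDeg 𝒜 (n + 1) b) := by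
  have : resD 𝒜 n (Finsupp.single b 1) = b.1.2 := by
    simp only [resD, Stage.cover]
    erw [Finsupp.linearCombination_single, one_smul]
  rw [this]
  exact b.2.1

theorem aug_surjective : Function.Surjective (aug 𝒜) := by
  intro x
  obtain ⟨r, rfl⟩ := (maxIdeal 𝒜).mkQ_surjective x
  exact ⟨Finsupp.single PUnit.unit r, by simp [aug]⟩

variable [GradedAlgebra 𝒜]

/-- The component of degree `j` of an element of a graded free module. -/
def comp {ι : Type u} (deg : ι → ℤ) (j : ℤ) : (ι →₀ R) →ₗ[K] (ι →₀ R) :=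
  Finsupp.lsum K fun a => (Finsupp.lsingle a) ∘ₗ GradedAlgebra.proj 𝒜 (j - deg a)

theorem comp_single {ι : Type u} (deg : ι → ℤ) (j : ℤ) (a : ι) (r : R) :
    comp 𝒜 deg j (Finsupp.single a r) =
      Finsupp.single a (GradedAlgebra.proj 𝒜 (j - deg a) r) := by
  simp [comp]

theorem comp_apply {ι : Type u} (deg : ι → ℤ) (j : ℤ) (f : ι →₀ R) (a : ι) :
    comp 𝒜 deg j f a = GradedAlgebra.proj 𝒜 (j - deg a) (f a) := by
  classical
  induction f using Finsupp.induction_linear with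
  | zero => simp
  | add f g hf hg => rw [map_add, Finsupp.add_apply, hf, hg, Finsupp.add_apply, map_add]
  | single b r =>
    rw [comp_single, Finsupp.single_apply, Finsupp.single_apply]
    split_ifs with h
    · rw [h]
    · rw [map_zero]

theorem comp_mem {ι : Type u} (deg : ι → ℤ) (j : ℤ) (f : ι →₀ R) :
    comp 𝒜 deg j f ∈ freeGrading 𝒜 deg j := by
  intro a
  rw [comp_apply]
  exact (DirectSum.decompose 𝒜 (f a) (j - deg a)).2

/-- Every element of a graded free module is a sum of components. -/
theorem mem_span_comp {ι : Type u} (deg : ι → ℤ) (f : ι →₀ R) :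
    f ∈ Submodule.span R (Set.range fun j => comp 𝒜 deg j f) := by
  classical
  have key : ∃ s₀ : Finset ℤ, ∀ s, s₀ ⊆ s → ∑ j ∈ s, comp 𝒜 deg j f = f := by
    induction f using Finsupp.induction_linear with
    | zero => exact ⟨∅, fun s _ => by simp⟩
    | add f g hf hg =>
      obtain ⟨s, hs⟩ := hf
      obtain ⟨t, ht⟩ := hg
      refine ⟨s ∪ t, fun r hr => ?_⟩
      simp only [map_add, Finset.sum_add_distrib]
      rw [hs r (Finset.union_subset_left hr), ht r (Finset.union_subset_right hr)]
    | single a r =>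
      refine ⟨(DirectSum.decompose 𝒜 r).support.image fun i => i + deg a, fun s hs => ?_⟩
      have h1 : ∑ j ∈ s, GradedAlgebra.proj 𝒜 (j - deg a) r = r := by
        rw [← Finset.sum_subset hs]
        · rw [Finset.sum_image (fun x _ y _ h => add_right_cancel h)]
          simp only [add_sub_cancel_right, GradedAlgebra.proj_apply]
          exact DirectSum.sum_support_decompose 𝒜 r
        · intro j _ hj
          rw [GradedAlgebra.proj_apply]
          by_contra hne
          refine hj (Finset.mem_image.2 ⟨j - deg a, ?_, by ring⟩)
          rw [DFinsupp.mem_support_iff]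
          exact fun h => hne (by rw [h]; rfl)
      simp only [comp_single]
      rw [← Finsupp.single_finsetSum, h1]
  obtain ⟨s, hs⟩ := key
  have hmem : ∑ j ∈ s, comp 𝒜 deg j f ∈
      Submodule.span R (Set.range fun j => comp 𝒜 deg j f) :=
    Submodule.sum_mem _ fun j _ => Submodule.subset_span (Set.mem_range_self j)
  rwa [hs s subset_rfl] at hmem

/-- A submodule of a graded free module is homogeneous if it contains the components of its
elements. -/
def Stage.IsHomogeneous (s : Stage R) : Prop :=
  ∀ f ∈ s.ker, ∀ j, comp 𝒜 s.deg j f ∈ s.ker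

theorem Stage.range_cover (s : Stage R) (hs : s.IsHomogeneous 𝒜) :
    LinearMap.range (s.cover 𝒜) = s.ker := by
  rw [Stage.cover, Finsupp.range_linearCombination]
  apply le_antisymm
  · rw [Submodule.span_le]
    rintro _ ⟨p, rfl⟩
    exact p.2.2
  · intro f hf
    refine Submodule.span_mono ?_ (mem_span_comp 𝒜 s.deg f)
    rintro _ ⟨j, rfl⟩
    exact ⟨⟨(j, comp 𝒜 s.deg j f), comp_mem 𝒜 s.deg j f, hs f hf j⟩, rfl⟩

theorem Stage.cover_comp (s : Stage R) (j : ℤ) (f : s.Gen 𝒜 →₀ R) :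
    s.cover 𝒜 (comp 𝒜 (s.next 𝒜).deg j f) = comp 𝒜 s.deg j (s.cover 𝒜 f) := by
  induction f using Finsupp.induction_linear with
  | zero => simp
  | add f g hf hg =>
    have h1 := (comp 𝒜 (s.next 𝒜).deg j).map_add f g
    have h2 := (s.cover 𝒜).map_add f g
    have h3 := (comp 𝒜 s.deg j).map_add (s.cover 𝒜 f) (s.cover 𝒜 g)
    rw [h2, h3, ← hf, ← hg, ← map_add]
    exact congrArg _ h1
  | single p r =>
    have h1 := comp_single 𝒜 (s.next 𝒜).deg j p r
    have h2 : ∀ x : R, s.cover 𝒜 (Finsupp.single p x) = x • p.1.2 := fun x => by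
      simp [Stage.cover]
    refine (congrArg (s.cover 𝒜) h1).trans ?_
    rw [h2, h2]
    ext a
    rw [comp_apply, Finsupp.smul_apply, Finsupp.smul_apply, smul_eq_mul, smul_eq_mul,
      GradedAlgebra.proj_apply, GradedAlgebra.proj_apply]
    have h3 := DirectSum.coe_decompose_mul_add_of_right_mem 𝒜 (i := j - p.1.1) (a := r)
      (p.2.1 a)
    rw [show j - p.1.1 + (p.1.1 - s.deg a) = j - s.deg a by ring] at h3
    exact h3.symm

theorem stage_isHomogeneous (n : ℕ) : (stage 𝒜 n).IsHomogeneous 𝒜 := by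
  induction n with
  | zero =>
    intro f hf j
    have hm : (maxIdeal 𝒜).IsHomogeneous 𝒜 :=
      Ideal.homogeneous_span 𝒜 _ fun x hx => by
        obtain ⟨i, _, hi⟩ := hx
        exact ⟨i, hi⟩
    change aug 𝒜 f = 0 at hf
    change aug 𝒜 (comp 𝒜 (stage 𝒜 0).deg j f) = 0
    have h1 : f PUnit.unit ∈ maxIdeal 𝒜 := (Submodule.Quotient.mk_eq_zero _).1 hf
    refine (Submodule.Quotient.mk_eq_zero _).2 ?_
    change (comp 𝒜 (stage 𝒜 0).deg j f) PUnit.unit ∈ maxIdeal 𝒜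
    have h2 := comp_apply 𝒜 (stage 𝒜 0).deg j f PUnit.unit
    rw [h2]
    exact hm _ h1
  | succ n ih =>
    intro f hf j
    change (stage 𝒜 n).cover 𝒜 f = 0 at hf
    change (stage 𝒜 n).cover 𝒜 (comp 𝒜 ((stage 𝒜 n).next 𝒜).deg j f) = 0
    rw [Stage.cover_comp, hf, map_zero]

theorem exact_resD_aug : Function.Exact (resD 𝒜 0) (aug 𝒜) := by
  rw [LinearMap.exact_iff]
  exact ((stage 𝒜 0).range_cover 𝒜 (stage_isHomogeneous 𝒜 0)).symm

theorem exact_resD (n : ℕ) : Function.Exact (resD 𝒜 (n + 1)) (resD 𝒜 n) := by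
  rw [LinearMap.exact_iff]
  exact ((stage 𝒜 (n + 1)).range_cover 𝒜 (stage_isHomogeneous 𝒜 (n + 1))).symm

end Resolution

/-! ### Graded Tor, Betti numbers, regularity -/

section Regularity

variable (𝒜 : ℤ → Submodule K R) {N : Type v} [AddCommGroup N] [Module R N] [Module K N]
  [IsScalarTower K R N] (𝒩 : ℤ → Submodule K N)

/-- The component of degree `j` of `N ⊗ P_i`, where `N` is graded by `𝒩`. -/
def torChains (i : ℕ) (j : ℤ) : Submodule K (N ⊗[R] (ResIdx 𝒜 i →₀ R)) :=
  Submodule.span K {z | ∃ (a : ResIdx 𝒜 i) (x : N), x ∈ 𝒩 (j - resDeg 𝒜 i a) ∧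
    z = x ⊗ₜ[R] Finsupp.single a (1 : R)}

/-- The differential `N ⊗ P_{i+1} → N ⊗ P_i`. -/
def torD (N : Type v) [AddCommGroup N] [Module R N] [Module K N] [IsScalarTower K R N] (i : ℕ) :
    N ⊗[R] (ResIdx 𝒜 (i + 1) →₀ R) →ₗ[K] N ⊗[R] (ResIdx 𝒜 i →₀ R) :=
  ((resD 𝒜 i).lTensor N).restrictScalars K

/-- The cycles of degree `j` of `N ⊗ P_i`. -/
def torCycles : (i : ℕ) → (j : ℤ) → Submodule K (N ⊗[R] (ResIdx 𝒜 i →₀ R))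
  | 0, j => torChains 𝒜 𝒩 0 j
  | i + 1, j => torChains 𝒜 𝒩 (i + 1) j ⊓ LinearMap.ker (torD 𝒜 N i)

/-- The boundaries of degree `j` in `N ⊗ P_i`. -/
def torBoundaries (i : ℕ) (j : ℤ) : Submodule K (N ⊗[R] (ResIdx 𝒜 i →₀ R)) :=
  (torChains 𝒜 𝒩 (i + 1) j).map (torD 𝒜 N i)

/-- `Tor_i^R(N, R ⧸ 𝔪)_j`: the component of degree `j` of the `i`-th homology of `N ⊗ P`. -/
abbrev GradedTor (i : ℕ) (j : ℤ) : Type (max u v) :=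
  torCycles 𝒜 𝒩 i j ⧸ (torBoundaries 𝒜 𝒩 i j).submoduleOf (torCycles 𝒜 𝒩 i j)

/-- The graded Betti number `β_{i,j}`. -/
def gradedBetti (i : ℕ) (j : ℤ) : Cardinal := Module.rank K (GradedTor 𝒜 𝒩 i j)

/-- `t_i`, the largest `j` with `β_{i,j} ≠ 0`; it is `-∞` if there is none. -/
def topDegree (i : ℕ) : EReal :=
  sSup {x | ∃ j : ℤ, gradedBetti 𝒜 𝒩 i j ≠ 0 ∧ x = ((j : ℝ) : EReal)}

/-- The Castelnuovo-Mumford regularity of the graded module `N` over `R`. -/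
def regularity : EReal := ⨆ i : ℕ, (topDegree 𝒜 𝒩 i - (i : EReal))

/-- `R` is a Koszul algebra: the regularity of its residue field is `0`. -/
def IsKoszul : Prop := regularity 𝒜 (residueGrading 𝒜) = 0

end Regularity

end Ring

/-! ### The Koszul complex

`F = R^n` has the basis `e_a = Pi.single a 1`, and `φ : F → R` sends `e_a` to `u a`.  The Koszul
complex is `M ⊗ ⋀F`; its differential is the antiderivation (left contraction) of `⋀F` extending
`φ`, tensored with `M`. -/

section Koszul

/-- The exterior algebra `⋀F` of `F = R^n`, as an `R`-module. -/
def Ext (R : Type u) [CommRing R] (n : ℕ) : Type u := ExteriorAlgebra R (Fin n → R)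

instance (R : Type u) [CommRing R] (n : ℕ) : AddCommGroup (Ext R n) :=
  inferInstanceAs (AddCommGroup (ExteriorAlgebra R (Fin n → R)))

instance (R : Type u) [CommRing R] (n : ℕ) : Module R (Ext R n) :=
  inferInstanceAs (Module R (ExteriorAlgebra R (Fin n → R)))

/-- `Ext R n` is the exterior algebra. -/
def extEquiv (R : Type u) [CommRing R] (n : ℕ) : ExteriorAlgebra R (Fin n → R) ≃ₗ[R] Ext R n :=
  LinearEquiv.refl R (ExteriorAlgebra R (Fin n → R))

variable {R : Type u} [CommRing R] {n : ℕ}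

/-- The linear form `φ : R^n → R` with `φ(e_a) = u a`. -/
def koszulForm (u : Fin n → R) : Module.Dual R (Fin n → R) := Fintype.linearCombination R u

/-- The antiderivation of `⋀F` extending `φ`. -/
def extD (u : Fin n → R) : Ext R n →ₗ[R] Ext R n :=
  (extEquiv R n).toLinearMap ∘ₗ
    CliffordAlgebra.contractLeft (Q := (0 : QuadraticForm R (Fin n → R))) (koszulForm u) ∘ₗ
    (extEquiv R n).symm.toLinearMap

/-- The exterior power `⋀^t F` inside `⋀F`. -/
def extPower (R : Type u) [CommRing R] (n t : ℕ) : Submodule R (Ext R n) :=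
  (⋀[R]^t (Fin n → R)).map (extEquiv R n).toLinearMap

/-- The element `e_{a_1} ∧ ⋯ ∧ e_{a_t}` of `⋀F`. -/
def wedge (R : Type u) [CommRing R] {n t : ℕ} (a : Fin t → Fin n) : Ext R n :=
  extEquiv R n (ExteriorAlgebra.ιMulti R t fun k => (Pi.single (a k) 1 : Fin n → R))

section Complex

variable (u : Fin n → R) (M : Type v) [AddCommGroup M] [Module R M]

/-- The Koszul differential on `M ⊗ ⋀F`. -/
def koszulD : M ⊗[R] Ext R n →ₗ[R] M ⊗[R] Ext R n := LinearMap.lTensor M (extD u)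

/-- `K_t = M ⊗ ⋀^t F`, inside `M ⊗ ⋀F`. -/
def koszulChains (R : Type u) [CommRing R] (n : ℕ) (M : Type v) [AddCommGroup M] [Module R M]
    (t : ℕ) : Submodule R (M ⊗[R] Ext R n) :=
  LinearMap.range (LinearMap.lTensor M (extPower R n t).subtype)

/-- The module `Z_t` of Koszul cycles. -/
def koszulCycles (t : ℕ) : Submodule R (M ⊗[R] Ext R n) :=
  koszulChains R n M t ⊓ LinearMap.ker (koszulD u M)

/-- The module `B_t` of Koszul boundaries. -/
def koszulBoundaries (t : ℕ) : Submodule R (M ⊗[R] Ext R n) :=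
  (koszulChains R n M (t + 1)).map (koszulD u M)

/-- The Koszul homology `H_t = Z_t / B_t`. -/
abbrev KoszulHomology (t : ℕ) : Type (max u v) :=
  koszulCycles u M t ⧸ (koszulBoundaries u M t).submoduleOf (koszulCycles u M t)

end Complex

variable {K : Type w} [Field K] [Algebra K R] {M : Type v} [AddCommGroup M] [Module R M]
  [Module K M] [IsScalarTower K R M]

/-- The component of degree `j` of `M ⊗ ⋀F`, where `e_a` has degree `d a`. -/
def koszulGrading (d : Fin n → ℤ) (ℳ : ℤ → Submodule K M) (j : ℤ) :
    Submodule K (M ⊗[R] Ext R n) :=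
  Submodule.span K {z | ∃ (t : ℕ) (a : Fin t → Fin n) (x : M), x ∈ ℳ (j - ∑ k, d (a k)) ∧
    z = x ⊗ₜ[R] wedge R a}

/-- The grading of the cycles `Z_t`. -/
def cyclesGrading (u : Fin n → R) (d : Fin n → ℤ) (ℳ : ℤ → Submodule K M) (t : ℕ) (j : ℤ) :
    Submodule K (koszulCycles u M t) :=
  (koszulGrading d ℳ j).comap ((koszulCycles u M t).subtype.restrictScalars K)

/-- The induced grading of the homology `H_t`. -/
def homologyGrading (u : Fin n → R) (d : Fin n → ℤ) (ℳ : ℤ → Submodule K M) (t : ℕ) (j : ℤ) :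
    Submodule K (KoszulHomology u M t) :=
  (cyclesGrading u d ℳ t j).map
    (((koszulBoundaries u M t).submoduleOf (koszulCycles u M t)).mkQ.restrictScalars K)

/-- `φ : F → R` is a graded map of degree `0` with image `I` and kernel contained in `𝔪F`; that is,
`u` is a minimal system of homogeneous generators of `I`, of degrees `d`. -/
structure IsMinimalPresentation (𝒜 : ℤ → Submodule K R) (I : Ideal R) (u : Fin n → R)
    (d : Fin n → ℤ) : Prop where
  mem : ∀ a, u a ∈ 𝒜 (d a)
  range_eq : LinearMap.range (koszulForm u) = I
  ker_le : LinearMap.ker (koszulForm u) ≤ maxIdeal 𝒜 • (⊤ : Submodule R (Fin n → R))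

end Koszul

end KoszulReg

end

/-! Write K_t, Z_t, B_t, H_t for the Koszul chains, cycles, boundaries and homology, and suppose r
bounds the regularity of M. The sequences 0 → B_t → Z_t → H_t → 0 and 0 → Z_{t+1} → K_{t+1} → B_t →
0 give reg B_t ≤ max(reg Z_t, reg H_t + 1) and reg Z_{t+1} ≤ max(reg K_{t+1}, reg B_t + 1)
(`RegularityLE.of_exact`). Since K_t is a finite sum of copies of M shifted by at most tc, reg K_t ≤
r + tc. The induction on t closes once reg H_t ≤ reg Z_t + c - 1, so each step costs c + 1.

That last inequality is the heart of the proof. If Z_t has regularity at most s, its elements of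
degree j lie in 𝔪^(j-s) Z_t (`RegularityLE.mem_pow_smul`). For j ≥ s + c this is inside (I + Ann M)
Z_t, hence inside B_t, because I and Ann M kill Koszul homology. So H_t vanishes in degrees above s
+ c - 1. Koszulness enters only now: over a Koszul algebra a module concentrated in degrees ≤ D has
regularity ≤ D (`regularityLE_of_forall_gt`).

The number c exists because the primes over the homogeneous ideal I + Ann M are maximal and the only
homogeneous maximal ideal is 𝔪, so some power of 𝔪 lies in I + Ann M.

Tor is handled through explicit coordinates in N ⊗ P_i, and regularity through integral upper
bounds, which makes infinite values harmless. -/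

noncomputable section

namespace KoszulReg

universe u v w

/-! ### Coordinates and gradings on N ⊗ (free module) -/

section FreeChains

variable {K : Type w} {R : Type u} [Field K] [CommRing R] [Algebra K R]
  {N : Type*} [AddCommGroup N] [Module R N] [Module K N] [IsScalarTower K R N]
  {L : Type*} [AddCommGroup L] [Module R L] [Module K L] [IsScalarTower K R L]
  {ι ι' : Type*}

open Classical in
/-- The coordinates of an element of `N ⊗ R^(ι)`. -/
def coords (R : Type u) [CommRing R] (N : Type*) [AddCommGroup N] [Module R N] (ι : Type*) :
    N ⊗[R] (ι →₀ R) ≃ₗ[R] (ι →₀ N) :=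
  TensorProduct.finsuppScalarRight R R N ι

theorem coords_symm_single (a : ι) (x : N) :
    (coords R N ι).symm (Finsupp.single a x) = x ⊗ₜ[R] Finsupp.single a (1 : R) := by
  classical exact TensorProduct.finsuppScalarRight_symm_apply_single a x

theorem coords_tmul_apply (x : N) (p : ι →₀ R) (a : ι) :
    coords R N ι (x ⊗ₜ[R] p) a = p a • x := by
  classical exact TensorProduct.finsuppScalarRight_apply_tmul_apply x p a

/-- The component of degree `j` of `N ⊗ R^(ι)`, for the graded free module `R^(ι)` with basis
vectors of degrees `deg`. -/
def freeChains (R : Type u) [CommRing R] [Algebra K R] {N : Type*} [AddCommGroup N] [Module R N]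
    [Module K N] [IsScalarTower K R N] {ι : Type*}
    (deg : ι → ℤ) (𝒩 : ℤ → Submodule K N) (j : ℤ) : Submodule K (N ⊗[R] (ι →₀ R)) :=
  Submodule.span K {z | ∃ (a : ι) (x : N), x ∈ 𝒩 (j - deg a) ∧
    z = x ⊗ₜ[R] Finsupp.single a (1 : R)}

theorem coords_tmul_single (a : ι) (x : N) :
    coords R N ι (x ⊗ₜ[R] Finsupp.single a (1 : R)) = Finsupp.single a x := by
  rw [← LinearEquiv.eq_symm_apply, coords_symm_single]

theorem tensor_finsupp_induction {p : N ⊗[R] (ι →₀ R) → Prop} (z : N ⊗[R] (ι →₀ R))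
    (h0 : p 0) (hadd : ∀ x y, p x → p y → p (x + y))
    (hs : ∀ (a : ι) (x : N), p (x ⊗ₜ[R] Finsupp.single a (1 : R))) : p z := by
  obtain ⟨f, rfl⟩ := (coords R N ι).symm.surjective z
  induction f using Finsupp.induction_linear with
  | zero => simpa using h0
  | add f g hf hg => rw [map_add]; exact hadd _ _ hf hg
  | single a x => rw [coords_symm_single]; exact hs a x

theorem mem_freeChains_iff {deg : ι → ℤ} {𝒩 : ℤ → Submodule K N} {j : ℤ}
    {z : N ⊗[R] (ι →₀ R)} :
    z ∈ freeChains R deg 𝒩 j ↔ ∀ a, coords R N ι z a ∈ 𝒩 (j - deg a) := by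
  classical
  constructor
  · intro hz a
    induction hz using Submodule.span_induction with
    | mem z hz =>
      obtain ⟨b, x, hx, rfl⟩ := hz
      rw [coords_tmul_single, Finsupp.single_apply]
      split_ifs with h
      · exact h ▸ hx
      · exact zero_mem _
    | zero => simp
    | add x y _ _ hx hy => rw [map_add]; exact add_mem hx hy
    | smul k x _ hx =>
      rw [← algebraMap_smul R k x, map_smul, algebraMap_smul]
      exact Submodule.smul_mem _ _ hx
  · intro h
    obtain ⟨f, rfl⟩ := (coords R N ι).symm.surjective z
    simp only [LinearEquiv.apply_symm_apply] at h
    rw [← f.sum_single, Finsupp.sum, map_sum]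
    refine Submodule.sum_mem _ fun a _ => ?_
    rw [coords_symm_single]
    exact Submodule.subset_span ⟨a, f a, h a, rfl⟩

theorem coords_lTensor (d : (ι →₀ R) →ₗ[R] (ι' →₀ R)) (z : N ⊗[R] (ι →₀ R)) (b : ι') :
    coords R N ι' (d.lTensor N z) b =
      (coords R N ι z).sum fun a x => d (Finsupp.single a 1) b • x := by
  classical
  induction z using tensor_finsupp_induction with
  | h0 => simp
  | hadd x y hx hy =>
    rw [map_add, map_add, map_add, Finsupp.add_apply, hx, hy, Finsupp.sum_add_index'] <;>
      simp
  | hs a x =>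
    rw [coords_tmul_single, LinearMap.lTensor_tmul,
      coords_tmul_apply, Finsupp.sum_single_index (by simp)]

theorem coords_rTensor (f : N →ₗ[R] L) (z : N ⊗[R] (ι →₀ R)) (a : ι) :
    coords R L ι (f.rTensor _ z) a = f (coords R N ι z a) := by
  classical
  induction z using tensor_finsupp_induction with
  | h0 => simp
  | hadd x y hx hy => simp only [map_add, Finsupp.add_apply, hx, hy]
  | hs a x =>
    simp only [LinearMap.rTensor_tmul, coords_tmul_apply, map_smul]

theorem rTensor_injective (f : N →ₗ[R] L) (hf : Function.Injective f) :
    Function.Injective (f.rTensor (ι →₀ R)) := by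
  rw [injective_iff_map_eq_zero]
  intro z hz
  refine (coords R N ι).map_eq_zero_iff.1 (Finsupp.ext fun a => hf ?_)
  rw [← coords_rTensor, hz]
  simp

theorem rTensor_mem_freeChains {𝒩 : ℤ → Submodule K N} {ℒ : ℤ → Submodule K L} (f : N →ₗ[R] L)
    (s : ℤ) (hf : ∀ j, ∀ x ∈ 𝒩 j, f x ∈ ℒ (j - s)) {deg : ι → ℤ} {j : ℤ} {z : N ⊗[R] (ι →₀ R)}
    (hz : z ∈ freeChains R deg 𝒩 j) : f.rTensor _ z ∈ freeChains R deg ℒ (j - s) := by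
  rw [mem_freeChains_iff] at hz ⊢
  intro a
  rw [coords_rTensor, show j - s - deg a = j - deg a - s by ring]
  exact hf _ _ (hz a)

theorem exists_rTensor_eq {L : Type*} [AddCommGroup L] [Module R L] {𝒩 : ℤ → Submodule K N}
    (f : N →ₗ[R] L) {z : L ⊗[R] (ι →₀ R)} {deg : ι → ℤ} {j : ℤ}
    (h : ∀ a, ∃ x ∈ 𝒩 (j - deg a), f x = coords R L ι z a) :
    ∃ y ∈ freeChains R deg 𝒩 j, f.rTensor _ y = z := by
  classical
  choose x hx hfx using h
  -- The chosen lifts are replaced by 0 off the support, since a lift of 0 need not be 0 and the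
  -- family must be finitely supported.
  let g : ι →₀ N := Finsupp.onFinset (coords R L ι z).support
    (fun a => if a ∈ (coords R L ι z).support then x a else 0) (by
      intro a ha; by_contra h; simp only [h, if_false, ne_eq, not_true_eq_false] at ha)
  have hg : ∀ a, g a = if a ∈ (coords R L ι z).support then x a else 0 := fun a => rfl
  refine ⟨(coords R N ι).symm g, mem_freeChains_iff.2 fun a => ?_,
    (coords R L ι).injective (Finsupp.ext fun a => ?_)⟩
  · rw [LinearEquiv.apply_symm_apply, hg]
    split_ifs
    · exact hx a
    · exact zero_mem _
  · rw [coords_rTensor, LinearEquiv.apply_symm_apply, hg]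
    split_ifs with h
    · exact hfx a
    · rw [map_zero, eq_comm]; simpa using h

theorem lTensor_mem_freeChains {𝒜 : ℤ → Submodule K R} {𝒩 : ℤ → Submodule K N}
    (hN : ∀ i j r x, r ∈ 𝒜 i → x ∈ 𝒩 j → r • x ∈ 𝒩 (i + j))
    {deg : ι → ℤ} {deg' : ι' → ℤ} (d : (ι →₀ R) →ₗ[R] (ι' →₀ R))
    (hd : ∀ a b, d (Finsupp.single a 1) b ∈ 𝒜 (deg a - deg' b)) {j : ℤ} {z : N ⊗[R] (ι →₀ R)}
    (hz : z ∈ freeChains R deg 𝒩 j) : d.lTensor N z ∈ freeChains R deg' 𝒩 j := by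
  rw [mem_freeChains_iff] at hz ⊢
  intro b
  rw [coords_lTensor]
  refine Submodule.sum_mem _ fun a _ => ?_
  have := hN _ _ _ _ (hd a b) (hz a)
  rwa [show deg a - deg' b + (j - deg a) = j - deg' b by ring] at this

end FreeChains

/-! ### Vanishing of graded Tor, integral bounds on regularity, exact sequences -/

section Tor

variable {K : Type w} {R : Type u} [Field K] [CommRing R] [Algebra K R]
  (𝒜 : ℤ → Submodule K R)
  {N : Type*} [AddCommGroup N] [Module R N] [Module K N] [IsScalarTower K R N]
  {L : Type*} [AddCommGroup L] [Module R L] [Module K L] [IsScalarTower K R L]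
  {Q : Type*} [AddCommGroup Q] [Module R Q] [Module K Q] [IsScalarTower K R Q]

/-- The vanishing of `Tor_i(N, R ⧸ 𝔪)_j`. -/
def TorVanishes (𝒩 : ℤ → Submodule K N) (i : ℕ) (j : ℤ) : Prop :=
  torCycles 𝒜 𝒩 i j ≤ torBoundaries 𝒜 𝒩 i j

/-- The graded module `N` has regularity at most the integer `r`. -/
def RegularityLE (𝒩 : ℤ → Submodule K N) (r : ℤ) : Prop :=
  ∀ (i : ℕ) (j : ℤ), i + r < j → TorVanishes 𝒜 𝒩 i j

variable {𝒜}

/-- Over a field a rank vanishes exactly when the space does; this trades cardinals for an inclusion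
suited to diagram chases. -/
theorem gradedBetti_eq_zero_iff {𝒩 : ℤ → Submodule K N} {i : ℕ} {j : ℤ} :
    gradedBetti 𝒜 𝒩 i j = 0 ↔ TorVanishes 𝒜 𝒩 i j := by
  rw [gradedBetti, rank_zero_iff, Submodule.Quotient.subsingleton_iff, TorVanishes,
    Submodule.submoduleOf_eq_top]

theorem regularity_le_iff {𝒩 : ℤ → Submodule K N} {x : EReal} :
    regularity 𝒜 𝒩 ≤ x ↔
      ∀ (i : ℕ) (j : ℤ), ¬ TorVanishes 𝒜 𝒩 i j → (((j - i : ℤ) : ℝ) : EReal) ≤ x := by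
  have key : ∀ (i : ℕ) (j : ℤ), (((j - i : ℤ) : ℝ) : EReal) ≤ x ↔
      ((j : ℝ) : EReal) ≤ x + (i : EReal) := by
    intro i j
    rw [← EReal.coe_natCast, ← EReal.sub_le_iff_le_add (Or.inl (EReal.coe_ne_bot _))
      (Or.inl (EReal.coe_ne_top _)), ← EReal.coe_sub]
    push_cast
    rfl
  simp only [regularity, iSup_le_iff, key, ← gradedBetti_eq_zero_iff]
  refine forall_congr' fun i => ?_
  rw [← EReal.coe_natCast, EReal.sub_le_iff_le_add (Or.inl (EReal.coe_ne_bot _))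
      (Or.inl (EReal.coe_ne_top _)), topDegree, sSup_le_iff]
  constructor
  · intro h j hj
    exact h _ ⟨j, hj, rfl⟩
  · rintro h _ ⟨j, hj, rfl⟩
    exact h j hj

theorem regularity_le_intCast_iff {𝒩 : ℤ → Submodule K N} {r : ℤ} :
    regularity 𝒜 𝒩 ≤ ((r : ℝ) : EReal) ↔ RegularityLE 𝒜 𝒩 r := by
  rw [regularity_le_iff]
  simp only [EReal.coe_le_coe_iff, Int.cast_le]
  refine forall_congr' fun i => forall_congr' fun j => ?_
  rw [← not_imp_not, not_not]
  exact imp_congr_left (by omega)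

/-- Regularity is determined by integral upper bounds, also when it is infinite. -/
theorem regularity_le_add_of_forall {𝒩 : ℤ → Submodule K N} {ℒ : ℤ → Submodule K L} (s : ℤ)
    (h : ∀ r, RegularityLE 𝒜 𝒩 r → RegularityLE 𝒜 ℒ (s + r)) :
    regularity 𝒜 ℒ ≤ ((s : ℝ) : EReal) + regularity 𝒜 𝒩 := by
  rw [regularity_le_iff]
  intro i j hij
  by_contra hlt
  -- If the bound fails at (i, j), then 𝒩 has regularity at most the integer j - i - s - 1, so ℒ has
  -- regularity at most j - i - 1, against the nonvanishing at (i, j). This also covers regularity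
  -- -∞.
  refine hij (h (j - i - s - 1) ?_ i j (by omega))
  rw [← regularity_le_intCast_iff, regularity_le_iff]
  intro i' j' hij'
  have h1 : (((j' - i' : ℤ) : ℝ) : EReal) ≤ regularity 𝒜 𝒩 := regularity_le_iff.1 le_rfl i' j' hij'
  have h2 : ((s : ℝ) : EReal) + (((j' - i' : ℤ) : ℝ) : EReal) < (((j - i : ℤ) : ℝ) : EReal) :=
    lt_of_le_of_lt (add_le_add_right h1 _) (not_le.1 hlt)
  rw [← EReal.coe_add, EReal.coe_lt_coe_iff] at h2
  rw [EReal.coe_le_coe_iff]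
  have h3 : s + (j' - i') < j - i := by exact_mod_cast h2
  exact_mod_cast (by omega : j' - i' ≤ j - i - s - 1)

theorem mem_torBoundaries {𝒩 : ℤ → Submodule K N} {i : ℕ} {j : ℤ}
    {z : N ⊗[R] (ResIdx 𝒜 i →₀ R)} :
    z ∈ torBoundaries 𝒜 𝒩 i j ↔
      ∃ y ∈ freeChains R (resDeg 𝒜 (i + 1)) 𝒩 j, (resD 𝒜 i).lTensor N y = z :=
  Iff.rfl

theorem mem_torCycles_succ {𝒩 : ℤ → Submodule K N} {i : ℕ} {j : ℤ}
    {z : N ⊗[R] (ResIdx 𝒜 (i + 1) →₀ R)} :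
    z ∈ torCycles 𝒜 𝒩 (i + 1) j ↔
      z ∈ freeChains R (resDeg 𝒜 (i + 1)) 𝒩 j ∧ (resD 𝒜 i).lTensor N z = 0 :=
  Iff.rfl

theorem torCycles_le_freeChains {𝒩 : ℤ → Submodule K N} {i : ℕ} {j : ℤ} :
    torCycles 𝒜 𝒩 i j ≤ freeChains R (resDeg 𝒜 i) 𝒩 j := by
  cases i with
  | zero => exact le_rfl
  | succ i => exact inf_le_left

theorem lTensor_rTensor {ι ι' : Type*} (f : N →ₗ[R] L) (d : (ι →₀ R) →ₗ[R] (ι' →₀ R))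
    (z : N ⊗[R] (ι →₀ R)) : d.lTensor L (f.rTensor _ z) = f.rTensor _ (d.lTensor N z) := by
  rw [← LinearMap.comp_apply, ← LinearMap.comp_apply, LinearMap.lTensor_comp_rTensor,
    LinearMap.rTensor_comp_lTensor]

theorem rTensor_mem_torCycles {𝒩 : ℤ → Submodule K N} {ℒ : ℤ → Submodule K L} (f : N →ₗ[R] L)
    (s : ℤ) (hf : ∀ j, ∀ x ∈ 𝒩 j, f x ∈ ℒ (j - s)) {i : ℕ} {j : ℤ}
    {z : N ⊗[R] (ResIdx 𝒜 i →₀ R)} (hz : z ∈ torCycles 𝒜 𝒩 i j) :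
    f.rTensor _ z ∈ torCycles 𝒜 ℒ i (j - s) := by
  cases i with
  | zero => exact rTensor_mem_freeChains f s hf hz
  | succ i =>
    rw [mem_torCycles_succ] at hz ⊢
    refine ⟨rTensor_mem_freeChains f s hf hz.1, ?_⟩
    rw [lTensor_rTensor, hz.2, map_zero]

theorem rTensor_mem_torBoundaries {𝒩 : ℤ → Submodule K N} {ℒ : ℤ → Submodule K L}
    (f : N →ₗ[R] L) (s : ℤ) (hf : ∀ j, ∀ x ∈ 𝒩 j, f x ∈ ℒ (j - s)) {i : ℕ} {j : ℤ}
    {z : N ⊗[R] (ResIdx 𝒜 i →₀ R)} (hz : z ∈ torBoundaries 𝒜 𝒩 i j) :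
    f.rTensor _ z ∈ torBoundaries 𝒜 ℒ i (j - s) := by
  obtain ⟨y, hy, rfl⟩ := mem_torBoundaries.1 hz
  exact mem_torBoundaries.2 ⟨_, rTensor_mem_freeChains f s hf hy, lTensor_rTensor _ _ _⟩

/-- If the identity of `N` factors through finitely many shifted graded modules `L(-s b)`, then
the regularity of `N` is bounded by theirs. -/
theorem RegularityLE.of_retract {𝒩 : ℤ → Submodule K N} {ℒ : ℤ → Submodule K L} {β : Type*}
    [Fintype β] (s : β → ℤ) (φ : β → N →ₗ[R] L) (ψ : β → L →ₗ[R] N)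
    (hφ : ∀ b j, ∀ x ∈ 𝒩 j, φ b x ∈ ℒ (j - s b))
    (hψ : ∀ b j, ∀ x ∈ ℒ j, ψ b x ∈ 𝒩 (j + s b))
    (hid : ∀ x, ∑ b, ψ b (φ b x) = x) {r r' : ℤ} (hL : RegularityLE 𝒜 ℒ r)
    (hs : ∀ b, r + s b ≤ r') : RegularityLE 𝒜 𝒩 r' := by
  intro i j hij z hz
  have hz' : z = ∑ b, (ψ b).rTensor _ ((φ b).rTensor _ z) := by
    have h1 : (∑ b, ψ b ∘ₗ φ b) = LinearMap.id := by
      ext x; simpa using hid x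
    have h2 := congrArg (fun g => LinearMap.rTensor (ResIdx 𝒜 i →₀ R) g z) h1
    simp only [LinearMap.rTensor_id, LinearMap.id_apply] at h2
    rw [← LinearMap.coe_rTensorHom, map_sum, LinearMap.sum_apply] at h2
    simp only [LinearMap.coe_rTensorHom, LinearMap.rTensor_comp, LinearMap.comp_apply] at h2
    exact h2.symm
  rw [hz']
  refine Submodule.sum_mem _ fun b _ => ?_
  have h3 := hL i (j - s b) (by have := hs b; omega) (rTensor_mem_torCycles _ _ (hφ b) hz)
  have h4 := rTensor_mem_torBoundaries (ψ b) (-s b)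
    (fun j x hx => by rw [sub_neg_eq_add]; exact hψ b j x hx) h3
  rwa [show j - s b - -s b = j by ring] at h4

theorem resD_single_apply_mem (i : ℕ) (a : ResIdx 𝒜 (i + 1)) (b : ResIdx 𝒜 i) :
    resD 𝒜 i (Finsupp.single a 1) b ∈ 𝒜 (resDeg 𝒜 (i + 1) a - resDeg 𝒜 i b) :=
  resD_single_mem 𝒜 i a b

variable [GradedAlgebra 𝒜]

theorem lTensor_resD_comp {N : Type*} [AddCommGroup N] [Module R N] (i : ℕ) (z : N ⊗[R] (ResIdx 𝒜 (i + 1 + 1) →₀ R)) :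
    (resD 𝒜 i).lTensor N ((resD 𝒜 (i + 1)).lTensor N z) = 0 := by
  rw [← LinearMap.comp_apply, ← LinearMap.lTensor_comp, (exact_resD 𝒜 i).linearMap_comp_eq_zero]
  simp

/-- A piece of the long exact sequence of `Tor` for `0 → N → L → Q → 0`. -/
theorem TorVanishes.of_exact {𝒩 : ℤ → Submodule K N} {ℒ : ℤ → Submodule K L}
    {𝒬 : ℤ → Submodule K Q} (hsmul : ∀ i j r x, r ∈ 𝒜 i → x ∈ ℒ j → r • x ∈ ℒ (i + j))
    (f : N →ₗ[R] L) (g : L →ₗ[R] Q) (hf : Function.Injective f)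
    (hfd : ∀ j, ∀ x ∈ 𝒩 j, f x ∈ ℒ j) (hgd : ∀ j, ∀ x ∈ ℒ j, g x ∈ 𝒬 j)
    (hgf : ∀ x, g (f x) = 0) (hex : ∀ j, ∀ x ∈ ℒ j, g x = 0 → ∃ y ∈ 𝒩 j, f y = x)
    (hsurj : ∀ j, ∀ x ∈ 𝒬 j, ∃ y ∈ ℒ j, g y = x) {i : ℕ} {j : ℤ}
    (hL : TorVanishes 𝒜 ℒ i j) (hQ : TorVanishes 𝒜 𝒬 (i + 1) j) : TorVanishes 𝒜 𝒩 i j := by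
  have hfd' : ∀ j, ∀ x ∈ 𝒩 j, f x ∈ ℒ (j - 0) := by simpa using hfd
  have hgd' : ∀ j, ∀ x ∈ ℒ j, g x ∈ 𝒬 (j - 0) := by simpa using hgd
  have hcomp : g ∘ₗ f = 0 := LinearMap.ext hgf
  intro z hz
  have h1 := rTensor_mem_torCycles f 0 hfd' hz
  rw [sub_zero] at h1
  -- The chase: f z bounds some y because Tor_i of L vanishes. The image g y is a cycle, hence
  -- bounds some w. Subtracting the boundary of a homogeneous lift of w moves y into N without
  -- changing its own boundary.
  obtain ⟨y, hy, hyz⟩ := mem_torBoundaries.1 (hL h1)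
  have h2 : g.rTensor _ y ∈ torCycles 𝒜 𝒬 (i + 1) j := by
    rw [mem_torCycles_succ]
    refine ⟨by simpa using rTensor_mem_freeChains g 0 hgd' hy, ?_⟩
    rw [lTensor_rTensor, hyz, ← LinearMap.comp_apply, ← LinearMap.rTensor_comp, hcomp]
    simp
  obtain ⟨w, hw, hwy⟩ := mem_torBoundaries.1 (hQ h2)
  obtain ⟨w', hw', rfl⟩ := exists_rTensor_eq (𝒩 := ℒ) (z := w) (deg := resDeg 𝒜 (i + 1 + 1))
    (j := j) g fun a => hsurj _ _ (mem_freeChains_iff.1 hw a)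
  have h3 : y - (resD 𝒜 (i + 1)).lTensor L w' ∈ freeChains R (resDeg 𝒜 (i + 1)) ℒ j :=
    Submodule.sub_mem _ hy
      (lTensor_mem_freeChains hsmul _ (fun a b => resD_single_apply_mem (i + 1) a b) hw')
  have h4 : g.rTensor _ (y - (resD 𝒜 (i + 1)).lTensor L w') = 0 := by
    rw [map_sub, ← lTensor_rTensor, hwy, sub_self]
  obtain ⟨v, hv, hvy⟩ := exists_rTensor_eq (𝒩 := 𝒩)
    (z := y - (resD 𝒜 (i + 1)).lTensor L w') (deg := resDeg 𝒜 (i + 1)) (j := j) f fun a =>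
      hex _ _ (mem_freeChains_iff.1 h3 a) (by rw [← coords_rTensor, h4]; simp)
  refine mem_torBoundaries.2 ⟨v, hv, rTensor_injective f hf ?_⟩
  rw [← lTensor_rTensor, hvy, map_sub, lTensor_resD_comp, sub_zero, hyz]

theorem RegularityLE.of_exact {𝒩 : ℤ → Submodule K N} {ℒ : ℤ → Submodule K L}
    {𝒬 : ℤ → Submodule K Q} (hsmul : ∀ i j r x, r ∈ 𝒜 i → x ∈ ℒ j → r • x ∈ ℒ (i + j))
    (f : N →ₗ[R] L) (g : L →ₗ[R] Q) (hf : Function.Injective f)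
    (hfd : ∀ j, ∀ x ∈ 𝒩 j, f x ∈ ℒ j) (hgd : ∀ j, ∀ x ∈ ℒ j, g x ∈ 𝒬 j)
    (hgf : ∀ x, g (f x) = 0) (hex : ∀ j, ∀ x ∈ ℒ j, g x = 0 → ∃ y ∈ 𝒩 j, f y = x)
    (hsurj : ∀ j, ∀ x ∈ 𝒬 j, ∃ y ∈ ℒ j, g y = x) {r s t : ℤ}
    (hL : RegularityLE 𝒜 ℒ r) (hQ : RegularityLE 𝒜 𝒬 s) (hr : r ≤ t) (hs : s + 1 ≤ t) :
    RegularityLE 𝒜 𝒩 t := fun i j hij =>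
  TorVanishes.of_exact hsmul f g hf hfd hgd hgf hex hsurj (hL i j (by omega))
    (hQ (i + 1) j (by push_cast; omega))

end Tor

/-! ### Homogeneous components of a standard graded algebra -/

section StandardGraded

variable {K : Type w} {R : Type u} [Field K] [CommRing R] [Algebra K R]
  {𝒜 : ℤ → Submodule K R}

theorem mem_maxIdeal_of_pos {i : ℤ} (hi : 0 < i) {x : R} (hx : x ∈ 𝒜 i) : x ∈ maxIdeal 𝒜 :=
  Ideal.subset_span ⟨i, hi, hx⟩

variable [GradedAlgebra 𝒜]

/-- A standard graded algebra is spanned by homogeneous elements `x` of degree `n ≥ 0` lying in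
`𝔪 ^ n`, with `x = 1` if `n = 0`. -/
theorem IsStandardGraded.span_eq_top (hR : IsStandardGraded 𝒜) :
    Submodule.span K {x | ∃ n : ℕ, x ∈ 𝒜 n ∧ x ∈ maxIdeal 𝒜 ^ n ∧ (n = 0 → x = 1)} = ⊤ := by
  rw [eq_top_iff, ← Algebra.top_toSubmodule, ← hR.adjoin_one, Algebra.adjoin_eq_span]
  refine Submodule.span_mono fun x hx => ?_
  induction hx using Submonoid.closure_induction with
  | mem x hx =>
    exact ⟨1, hx, by rw [pow_one]; exact mem_maxIdeal_of_pos one_pos hx, fun h => absurd h one_ne_zero⟩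
  | one => exact ⟨0, by simpa using SetLike.GradedOne.one_mem (A := 𝒜), by simp, fun _ => rfl⟩
  | mul x y _ _ hx hy =>
    obtain ⟨m, hx, hxm, hx0⟩ := hx
    obtain ⟨n, hy, hyn, hy0⟩ := hy
    refine ⟨m + n, by push_cast; exact SetLike.GradedMul.mul_mem hx hy, ?_, fun h => ?_⟩
    · rw [pow_add]; exact Ideal.mul_mem_mul hxm hyn
    · rw [hx0 (by omega), hy0 (by omega), one_mul]

/-- The three properties are linear in `r`, so they need testing only on the spanning set of
`IsStandardGraded.span_eq_top`. -/
theorem IsStandardGraded.proj_mem (hR : IsStandardGraded 𝒜) (r : R) (i : ℤ) :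
    (i < 0 → GradedAlgebra.proj 𝒜 i r = 0) ∧
      (i = 0 → GradedAlgebra.proj 𝒜 i r ∈ Set.range (algebraMap K R)) ∧
      GradedAlgebra.proj 𝒜 i r ∈ maxIdeal 𝒜 ^ i.toNat := by
  have hr : r ∈ Submodule.span K
      {x | ∃ n : ℕ, x ∈ 𝒜 n ∧ x ∈ maxIdeal 𝒜 ^ n ∧ (n = 0 → x = 1)} := by
    rw [hR.span_eq_top]; trivial
  induction hr using Submodule.span_induction with
  | mem x hx =>
    obtain ⟨n, hx, hxn, hx0⟩ := hx
    rw [GradedAlgebra.proj_apply]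
    by_cases hin : i = n
    · subst hin
      rw [DirectSum.decompose_of_mem_same 𝒜 hx]
      refine ⟨fun h => by omega, fun h => ?_, by simpa using hxn⟩
      rw [hx0 (by exact_mod_cast h)]
      exact ⟨1, map_one _⟩
    · rw [DirectSum.decompose_of_mem_ne 𝒜 hx (Ne.symm hin)]
      exact ⟨fun _ => rfl, fun _ => ⟨0, map_zero _⟩, zero_mem _⟩
  | zero => rw [map_zero]; exact ⟨fun _ => rfl, fun _ => ⟨0, map_zero _⟩, zero_mem _⟩
  | add x y _ _ hx hy =>
    rw [map_add]
    refine ⟨fun h => by rw [hx.1 h, hy.1 h, add_zero], fun h => ?_, add_mem hx.2.2 hy.2.2⟩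
    obtain ⟨a, ha⟩ := hx.2.1 h
    obtain ⟨b, hb⟩ := hy.2.1 h
    exact ⟨a + b, by rw [map_add, ha, hb]⟩
  | smul k x _ hx =>
    rw [map_smul]
    refine ⟨fun h => by rw [hx.1 h, smul_zero], fun h => ?_, ?_⟩
    · obtain ⟨a, ha⟩ := hx.2.1 h
      exact ⟨k * a, by rw [map_mul, ha, Algebra.smul_def]⟩
    · rw [Algebra.smul_def]
      exact Ideal.mul_mem_left _ _ hx.2.2

theorem proj_eq_self {i : ℤ} {x : R} (hx : x ∈ 𝒜 i) : GradedAlgebra.proj 𝒜 i x = x := by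
  rw [GradedAlgebra.proj_apply, DirectSum.decompose_of_mem_same 𝒜 hx]

theorem IsStandardGraded.eq_zero_of_neg (hR : IsStandardGraded 𝒜) {i : ℤ} (hi : i < 0) {x : R}
    (hx : x ∈ 𝒜 i) : x = 0 := by
  rw [← proj_eq_self hx]; exact (hR.proj_mem x i).1 hi

theorem IsStandardGraded.exists_algebraMap (hR : IsStandardGraded 𝒜) {x : R} (hx : x ∈ 𝒜 0) :
    ∃ k, algebraMap K R k = x := by
  have := (hR.proj_mem x 0).2.1 rfl
  rwa [proj_eq_self hx] at this

theorem IsStandardGraded.mem_pow (hR : IsStandardGraded 𝒜) {i : ℤ} {x : R} (hx : x ∈ 𝒜 i) :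
    x ∈ maxIdeal 𝒜 ^ i.toNat := by
  have := (hR.proj_mem x i).2.2
  rwa [proj_eq_self hx] at this

theorem IsStandardGraded.proj_zero_of_mem (hR : IsStandardGraded 𝒜) {x : R}
    (hx : x ∈ maxIdeal 𝒜) : GradedAlgebra.proj 𝒜 0 x = 0 := by
  -- Quantifying over all multiples lets the span induction pass through scalar multiplication. For
  -- x of degree i > 0, the degree 0 component of t x is the component of t in degree -i, times x.
  have key : ∀ t : R, GradedAlgebra.proj 𝒜 0 (t * x) = 0 := by
    refine Submodule.span_induction (p := fun x _ => ∀ t : R, GradedAlgebra.proj 𝒜 0 (t * x) = 0)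
      ?_ (fun t => by rw [mul_zero, map_zero])
      (fun x y _ _ hx hy t => by rw [mul_add, map_add, hx, hy, add_zero])
      (fun r x _ hx t => by rw [smul_eq_mul, ← mul_assoc]; exact hx _) hx
    rintro x ⟨i, hi, hx⟩ t
    have h := DirectSum.coe_decompose_mul_add_of_right_mem 𝒜 (i := -i) (a := t) hx
    rw [neg_add_cancel] at h
    rw [GradedAlgebra.proj_apply, h, ← GradedAlgebra.proj_apply,
      (hR.proj_mem t (-i)).1 (by omega), zero_mul]
  simpa using key 1

theorem IsStandardGraded.eq_zero_of_mem_maxIdeal (hR : IsStandardGraded 𝒜) {i : ℤ} (hi : i ≤ 0)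
    {x : R} (hx : x ∈ 𝒜 i) (hx' : x ∈ maxIdeal 𝒜) : x = 0 := by
  rcases hi.lt_or_eq with hi | rfl
  · exact hR.eq_zero_of_neg hi hx
  · rw [← proj_eq_self hx, hR.proj_zero_of_mem hx']

theorem IsStandardGraded.maxIdeal_ne_top [Nontrivial R] (hR : IsStandardGraded 𝒜) :
    maxIdeal 𝒜 ≠ ⊤ := fun h =>
  one_ne_zero (hR.eq_zero_of_mem_maxIdeal le_rfl (SetLike.GradedOne.one_mem (A := 𝒜))
    (h ▸ Submodule.mem_top))

/-! ### The residue field -/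

theorem IsStandardGraded.mem_maxIdeal_of_ne (hR : IsStandardGraded 𝒜) {i : ℤ} (hi : i ≠ 0) {x : R}
    (hx : x ∈ 𝒜 i) : x ∈ maxIdeal 𝒜 := by
  rcases hi.lt_or_gt with hi | hi
  · rw [hR.eq_zero_of_neg hi hx]; exact zero_mem _
  · exact mem_maxIdeal_of_pos hi hx

theorem mk_mem_residueGrading (k : K) :
    k • (1 : R ⧸ maxIdeal 𝒜) ∈ residueGrading 𝒜 0 :=
  Submodule.smul_mem _ _ ⟨1, SetLike.GradedOne.one_mem (A := 𝒜), rfl⟩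

theorem IsStandardGraded.eq_zero_of_mem_residueGrading (hR : IsStandardGraded 𝒜) {i : ℤ} (hi : i ≠ 0)
    {x : R ⧸ maxIdeal 𝒜} (hx : x ∈ residueGrading 𝒜 i) : x = 0 := by
  obtain ⟨r, hr, rfl⟩ := hx
  exact (Submodule.Quotient.mk_eq_zero _).2 (hR.mem_maxIdeal_of_ne hi hr)

theorem IsStandardGraded.residueGrading_zero (hR : IsStandardGraded 𝒜)
    {x : R ⧸ maxIdeal 𝒜} (hx : x ∈ residueGrading 𝒜 0) :
    ∃ k : K, x = k • (1 : R ⧸ maxIdeal 𝒜) := by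
  obtain ⟨r, hr, rfl⟩ := hx
  obtain ⟨k, rfl⟩ := hR.exists_algebraMap hr
  refine ⟨k, ?_⟩
  rw [Algebra.algebraMap_eq_smul_one, map_smul]
  rfl

/-- Coordinate functions for the residue field and for `R_0`. -/
theorem IsStandardGraded.exists_residue_coordinate [Nontrivial R] (hR : IsStandardGraded 𝒜) :
    ∃ (η : (R ⧸ maxIdeal 𝒜) →ₗ[K] K) (ε : R → K),
      (∀ k : K, η (k • (1 : R ⧸ maxIdeal 𝒜)) = k) ∧ ∀ r ∈ 𝒜 0, algebraMap K R (ε r) = r := by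
  have h1 : (1 : R ⧸ maxIdeal 𝒜) ≠ 0 := by
    intro h
    exact hR.maxIdeal_ne_top ((Ideal.eq_top_iff_one _).2 (Ideal.Quotient.eq_zero_iff_mem.1 h))
  obtain ⟨η, hη⟩ := LinearMap.exists_leftInverse_of_injective
    (LinearMap.toSpanSingleton K (R ⧸ maxIdeal 𝒜) 1) (LinearMap.ker_toSpanSingleton K h1)
  -- `ε` is a bare function with the default value 0 off R_0; linearity is never needed.
  have : ∀ r, ∃ k, r ∈ 𝒜 0 → algebraMap K R k = r := by
    intro r
    by_cases hr : r ∈ 𝒜 0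
    · obtain ⟨k, hk⟩ := hR.exists_algebraMap hr
      exact ⟨k, fun _ => hk⟩
    · exact ⟨0, fun h => absurd h hr⟩
  choose ε hε using this
  exact ⟨η, ε, fun k => LinearMap.congr_fun hη k, hε⟩

end StandardGraded

/-! ### Extending exactness of matrices to vector valued families -/

section RowSum

variable {K : Type w} [Field K] {V W : Type*} [AddCommGroup V] [Module K V] [AddCommGroup W]
  [Module K W] {α β γ : Type*}

/-- The sum `∑ κ a • f a`. -/
def rowSum (V : Type*) [AddCommGroup V] [Module K V] (κ : α → K) : (α →₀ V) →ₗ[K] V :=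
  Finsupp.lsum K fun a => κ a • LinearMap.id

theorem rowSum_apply (κ : α → K) (f : α →₀ V) : rowSum V κ f = f.sum fun a x => κ a • x :=
  rfl

theorem map_rowSum (κ : α → K) (φ : V →ₗ[K] W) (f : α →₀ V) :
    rowSum W κ (Finsupp.mapRange.linearMap φ f) = φ (rowSum V κ f) := by
  induction f using Finsupp.induction_linear with
  | zero => simp
  | add f g hf hg => rw [map_add, map_add, map_add, map_add, hf, hg]
  | single a x => simp [rowSum]

/-- If the complex of matrices `κ`, `μ` is exact over `K`, on families supported on `q`, then it
is exact on families of elements of a vector space. -/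
theorem exists_rowSum_eq {κ : α → β → K} {μ : β → γ → K} {p : α → Prop} {q : β → Prop}
    {s : γ → Prop}
    (h : ∀ c : β →₀ K, (∀ b, ¬ q b → c b = 0) → (∀ x, s x → rowSum K (μ · x) c = 0) →
      ∃ c' : α →₀ K, (∀ a, ¬ p a → c' a = 0) ∧ ∀ b, q b → rowSum K (κ · b) c' = c b)
    (U : Submodule K V) (f : β →₀ V) (hfU : ∀ b, f b ∈ U) (hfq : ∀ b, ¬ q b → f b = 0)
    (hf : ∀ x, s x → rowSum V (μ · x) f = 0) :
    ∃ g : α →₀ V, (∀ a, ¬ p a → g a = 0) ∧ (∀ a, g a ∈ U) ∧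
      ∀ b, q b → rowSum V (κ · b) g = f b := by
  classical
  let B := Module.Basis.ofVectorSpace K V
  have h1 : ∀ i, ∃ c' : α →₀ K, (∀ a, ¬ p a → c' a = 0) ∧
      ∀ b, q b → rowSum K (κ · b) c' = B.repr (f b) i := by
    intro i
    -- Solve one basis coordinate of V at a time. Finitely many coordinates occur in `f`, so the
    -- solutions reassemble into a finite family.
    refine h (Finsupp.mapRange.linearMap (B.coord i) f) (fun b hb => ?_) fun x hx => ?_
    · simp [hfq b hb]
    · rw [map_rowSum, hf x hx, map_zero]
  choose c' hc'p hc' using h1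
  obtain ⟨P, hP⟩ := LinearMap.exists_leftInverse_of_injective U.subtype U.ker_subtype
  let T := f.support.biUnion fun b => (B.repr (f b)).support
  let g : α →₀ V := ∑ i ∈ T, Finsupp.mapRange.linearMap (LinearMap.toSpanSingleton K V (B i)) (c' i)
  have hg : ∀ b, q b → rowSum V (κ · b) g = f b := by
    intro b hb
    simp only [g, map_sum, map_rowSum, hc' _ b hb, LinearMap.toSpanSingleton_apply]
    conv_rhs => rw [← B.linearCombination_repr (f b), Finsupp.linearCombination_apply]
    refine (Finsupp.sum_of_support_subset _ ?_ (fun i k => k • B i)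
      fun i _ => zero_smul K (B i)).symm
    intro i hi
    refine Finset.mem_biUnion.2 ⟨b, Finsupp.mem_support_iff.2 fun h0 => ?_, hi⟩
    rw [h0, map_zero] at hi
    simp at hi
  -- The solution may leave U; a linear retraction onto U repairs this, and it fixes the values of
  -- `f`.
  refine ⟨Finsupp.mapRange.linearMap (U.subtype ∘ₗ P) g, fun a ha => ?_, fun a => ?_,
    fun b hb => ?_⟩
  · simp [g, Finsupp.finsetSum_apply, hc'p _ a ha]
  · simp
  · rw [map_rowSum, hg b hb, LinearMap.comp_apply]
    have := LinearMap.congr_fun hP ⟨f b, hfU b⟩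
    simp only [LinearMap.comp_apply, LinearMap.id_apply, Submodule.subtype_apply] at this
    rw [this]
    rfl

end RowSum

/-! ### Koszul algebras: regularity against top degree and generation -/

section KoszulVanishing

variable {K : Type w} {R : Type u} [Field K] [CommRing R] [Algebra K R]
  {𝒜 : ℤ → Submodule K R} [GradedAlgebra 𝒜]
  {N : Type*} [AddCommGroup N] [Module R N] [Module K N] [IsScalarTower K R N]

/-- The linear strands of the resolution of the residue field of a Koszul algebra are exact. -/
theorem exists_strand_eq (hR : IsStandardGraded 𝒜)
    (hK : RegularityLE 𝒜 (residueGrading 𝒜) 0) {η : (R ⧸ maxIdeal 𝒜) →ₗ[K] K} {ε : R → K}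
    (hη : ∀ k : K, η (k • (1 : R ⧸ maxIdeal 𝒜)) = k) (hε : ∀ r ∈ 𝒜 0, algebraMap K R (ε r) = r)
    {i : ℕ} {e : ℤ} (he : (i + 1 : ℕ) < e) (c : ResIdx 𝒜 (i + 1) →₀ K)
    (hce : ∀ b, ¬ resDeg 𝒜 (i + 1) b = e → c b = 0)
    (hc : ∀ x, resDeg 𝒜 i x = e →
      rowSum K (fun b => ε (resD 𝒜 i (Finsupp.single b 1) x)) c = 0) :
    ∃ c' : ResIdx 𝒜 (i + 1 + 1) →₀ K, (∀ a, ¬ resDeg 𝒜 (i + 1 + 1) a = e → c' a = 0) ∧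
      ∀ b, resDeg 𝒜 (i + 1) b = e →
        rowSum K (fun a => ε (resD 𝒜 (i + 1) (Finsupp.single a 1) b)) c' = c b := by
  let F := R ⧸ maxIdeal 𝒜
  have hsmul : ∀ r ∈ 𝒜 0, ∀ k : K, r • (k • (1 : F)) = (ε r * k) • (1 : F) := by
    intro r hr k
    conv_lhs => rw [← hε r hr, algebraMap_smul, smul_smul]
  have hzero : ∀ i ≠ 0, ∀ r ∈ 𝒜 i, ∀ x : F, r • x = 0 := by
    intro i hi r hr x
    obtain ⟨y, rfl⟩ := Submodule.Quotient.mk_surjective _ x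
    rw [← Submodule.Quotient.mk_smul, Submodule.Quotient.mk_eq_zero]
    exact Ideal.mul_mem_right _ _ (hR.mem_maxIdeal_of_ne hi hr)
  -- In degree e only basis vectors of degree e survive in (R/𝔪) ⊗ P, with scalar matrices as
  -- differentials. So `c` is a cycle there, and e above the homological degree makes it a boundary.
  let f : ResIdx 𝒜 (i + 1) →₀ F :=
    Finsupp.mapRange.linearMap (LinearMap.toSpanSingleton K F 1) c
  have hf : ∀ b, f b = c b • (1 : F) := fun b => rfl
  have hdiff : ∀ (n : ℕ) (c : ResIdx 𝒜 (n + 1) →₀ K)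
      (_ : ∀ b, ¬ resDeg 𝒜 (n + 1) b = e → c b = 0) (x : ResIdx 𝒜 n) (_ : resDeg 𝒜 n x = e),
      (Finsupp.mapRange.linearMap (LinearMap.toSpanSingleton K F 1) c).sum
        (fun a y => resD 𝒜 n (Finsupp.single a 1) x • y) =
      rowSum K (fun b => ε (resD 𝒜 n (Finsupp.single b 1) x)) c • (1 : F) := by
    intro n c hce x hx
    rw [rowSum_apply, Finsupp.mapRange.linearMap_apply,
      Finsupp.sum_mapRange_index (fun _ => smul_zero _), Finsupp.sum, Finsupp.sum,
      Finset.sum_smul]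
    refine Finset.sum_congr rfl fun a ha => ?_
    have hae : resDeg 𝒜 (n + 1) a = e := by
      by_contra h
      exact (Finsupp.mem_support_iff.1 ha) (hce a h)
    refine hsmul _ ?_ _
    have := resD_single_apply_mem n a x
    rwa [hae, hx, sub_self] at this
  have hcyc : (coords R F _).symm f ∈ torCycles 𝒜 (residueGrading 𝒜) (i + 1) e := by
    rw [mem_torCycles_succ]
    constructor
    · rw [mem_freeChains_iff]
      intro a
      rw [LinearEquiv.apply_symm_apply, hf]
      by_cases ha : resDeg 𝒜 (i + 1) a = e
      · rw [ha, sub_self]; exact mk_mem_residueGrading _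
      · rw [hce a ha, zero_smul]; exact zero_mem _
    · refine (coords R F _).map_eq_zero_iff.1 (Finsupp.ext fun x => ?_)
      rw [coords_lTensor, LinearEquiv.apply_symm_apply, Finsupp.zero_apply]
      by_cases hx : resDeg 𝒜 i x = e
      · rw [hdiff i c hce x hx, hc x hx, zero_smul]
      · refine Finset.sum_eq_zero fun a ha => ?_
        have hae : resDeg 𝒜 (i + 1) a = e := by
          by_contra h
          refine (Finsupp.mem_support_iff.1 ha) ?_
          rw [hf, hce a h, zero_smul]
        exact hzero _ (by rw [hae]; exact fun h => hx (by omega)) _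
          (resD_single_apply_mem i a x) _
  obtain ⟨y, hy, hyf⟩ := mem_torBoundaries.1 (hK (i + 1) e (by omega) hcyc)
  let c' : ResIdx 𝒜 (i + 1 + 1) →₀ K := Finsupp.mapRange.linearMap η (coords R F _ y)
  have hc'a : ∀ a, c' a = η (coords R F _ y a) := fun a => rfl
  have hy' := mem_freeChains_iff.1 hy
  have hc'e : ∀ a, ¬ resDeg 𝒜 (i + 1 + 1) a = e → c' a = 0 := by
    intro a ha
    rw [hc'a, hR.eq_zero_of_mem_residueGrading (fun h => ha (by omega)) (hy' a), map_zero]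
  have hyc : coords R F _ y = Finsupp.mapRange.linearMap (LinearMap.toSpanSingleton K F 1) c' := by
    ext a
    change _ = c' a • (1 : F)
    by_cases ha : resDeg 𝒜 (i + 1 + 1) a = e
    · have h := hy' a
      rw [ha, sub_self] at h
      obtain ⟨k, hk⟩ := hR.residueGrading_zero h
      rw [hc'a, hk, hη]
    · rw [hc'e a ha, zero_smul]
      exact hR.eq_zero_of_mem_residueGrading (fun h => ha (by omega)) (hy' a)
  refine ⟨c', hc'e, fun b hb => ?_⟩
  have h1 := congrArg (fun z => coords R F _ z b) hyf
  simp only [LinearEquiv.apply_symm_apply] at h1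
  rw [coords_lTensor, hyc, hdiff (i + 1) c' hc'e b hb, hf] at h1
  have h2 := congrArg η h1
  rwa [hη, hη] at h2

/-- Over a Koszul algebra the regularity of a graded module is at most its top degree. -/
theorem regularityLE_of_forall_gt [Nontrivial R] (hR : IsStandardGraded 𝒜)
    (hK : RegularityLE 𝒜 (residueGrading 𝒜) 0) {𝒩 : ℤ → Submodule K N}
    (hsmul : ∀ i j r x, r ∈ 𝒜 i → x ∈ 𝒩 j → r • x ∈ 𝒩 (i + j)) {D : ℤ}
    (hD : ∀ j, D < j → ∀ x ∈ 𝒩 j, x = 0) : RegularityLE 𝒜 𝒩 D := by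
  classical
  obtain ⟨η, ε, hη, hε⟩ := hR.exists_residue_coordinate
  intro i j hij z hz
  rcases i with _ | i
  · have : z = 0 := by
      refine (coords R N _).map_eq_zero_iff.1 (Finsupp.ext fun a => ?_)
      refine hD _ ?_ _ (mem_freeChains_iff.1 (torCycles_le_freeChains hz) a)
      change D < j - 0
      push_cast at hij
      omega
    rw [this]
    exact zero_mem _
  -- A coordinate at a basis vector of degree below j - D lies in a zero component of N. Hence only
  -- degrees from j - D on occur, and n bounds their number; the induction removes the highest one.
  · have key : ∀ n : ℕ, ∀ z ∈ torCycles 𝒜 𝒩 (i + 1) j,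
        (∀ a, coords R N _ z a ≠ 0 → resDeg 𝒜 (i + 1) a < j - D + n) →
        z ∈ torBoundaries 𝒜 𝒩 (i + 1) j := by
      intro n
      induction n with
      | zero =>
        intro z hz h
        have : z = 0 := by
          refine (coords R N _).map_eq_zero_iff.1 (Finsupp.ext fun a => ?_)
          by_contra h0
          have h1 := h a h0
          push_cast at h1
          exact h0 (hD _ (by omega) _ (mem_freeChains_iff.1 (torCycles_le_freeChains hz) a))
        rw [this]
        exact zero_mem _
      | succ n ih =>
        intro z hz h
        obtain ⟨hzc, hz0⟩ := mem_torCycles_succ.1 hz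
        have hzc' := mem_freeChains_iff.1 hzc
        set e : ℤ := j - D + n with he
        let F := coords R N _ z
        let f := F.filter fun a => resDeg 𝒜 (i + 1) a = e
        have hfe : ∀ b, ¬ resDeg 𝒜 (i + 1) b = e → f b = 0 := fun b hb =>
          Finsupp.filter_apply_neg _ _ hb
        have hfF : ∀ b, resDeg 𝒜 (i + 1) b = e → f b = F b := fun b hb =>
          Finsupp.filter_apply_pos _ _ hb
        have hrow : ∀ (n : ℕ) (g : ResIdx 𝒜 (n + 1) →₀ N)
            (_ : ∀ b, ¬ resDeg 𝒜 (n + 1) b = e → g b = 0) (x : ResIdx 𝒜 n)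
            (_ : resDeg 𝒜 n x = e),
            g.sum (fun a y => resD 𝒜 n (Finsupp.single a 1) x • y) =
            rowSum N (fun b => ε (resD 𝒜 n (Finsupp.single b 1) x)) g := by
          intro n g hg x hx
          rw [rowSum_apply]
          refine Finset.sum_congr rfl fun a ha => ?_
          have hae : resDeg 𝒜 (n + 1) a = e := by
            by_contra h
            exact (Finsupp.mem_support_iff.1 ha) (hg a h)
          have h1 := resD_single_apply_mem n a x
          rw [hae, hx, sub_self] at h1
          change _ = ε _ • g a
          rw [← algebraMap_smul R (ε _) (g a), hε _ h1]
        -- On a target of degree e, basis vectors of smaller degree contribute coefficients of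
        -- negative degree, hence nothing. So the top part `f` alone is a cycle of the strand of
        -- degree e.
        have hf0 : ∀ x, resDeg 𝒜 i x = e →
            rowSum N (fun b => ε (resD 𝒜 i (Finsupp.single b 1) x)) f = 0 := by
          intro x hx
          have h1 := congrArg (fun z => coords R N _ z x) hz0
          simp only [coords_lTensor, map_zero, Finsupp.zero_apply] at h1
          rw [← hrow i f hfe x hx, ← h1]
          refine Finset.sum_subset_zero_on_sdiff (fun a ha => ?_) (fun a ha => ?_) (fun a ha => ?_)
          · have h3 : resDeg 𝒜 (i + 1) a = e := by
              by_contra h3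
              exact (Finsupp.mem_support_iff.1 ha) (hfe a h3)
            rw [Finsupp.mem_support_iff, ← hfF a h3]
            exact Finsupp.mem_support_iff.1 ha
          · rw [Finset.mem_sdiff] at ha
            have h2 := h a (Finsupp.mem_support_iff.1 ha.1)
            have h3 : ¬ resDeg 𝒜 (i + 1) a = e := by
              intro h3
              refine ha.2 (Finsupp.mem_support_iff.2 ?_)
              rw [hfF a h3]
              exact Finsupp.mem_support_iff.1 ha.1
            push_cast at h2
            change resD 𝒜 i (Finsupp.single a 1) x • F a = 0
            rw [hR.eq_zero_of_neg _ (resD_single_apply_mem i a x), zero_smul]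
            omega
          · have h3 : resDeg 𝒜 (i + 1) a = e := by
              by_contra h3
              exact (Finsupp.mem_support_iff.1 ha) (hfe a h3)
            change _ • f a = _ • F a
            rw [hfF a h3]
        -- Here j > i + 1 + D gives e > i + 1, so the strand is exact, also with values in the
        -- single component of N of degree j - e.
        obtain ⟨g, hge, hgU, hg⟩ := exists_rowSum_eq
          (fun c hce hc => exists_strand_eq hR hK hη hε (by push_cast at hij ⊢; omega) c hce hc)
          (𝒩 (j - e)) f (fun b => by
            by_cases hb : resDeg 𝒜 (i + 1) b = e
            · rw [hfF b hb, ← hb]; exact hzc' b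
            · rw [hfe b hb]; exact zero_mem _) hfe hf0
        let y := (coords R N _).symm g
        have hy : y ∈ freeChains R (resDeg 𝒜 (i + 1 + 1)) 𝒩 j := by
          rw [mem_freeChains_iff]
          intro a
          simp only [y, LinearEquiv.apply_symm_apply]
          by_cases ha : resDeg 𝒜 (i + 1 + 1) a = e
          · rw [ha]; exact hgU a
          · rw [hge a ha]; exact zero_mem _
        have hdy : (resD 𝒜 (i + 1)).lTensor N y ∈ torBoundaries 𝒜 𝒩 (i + 1) j :=
          mem_torBoundaries.2 ⟨y, hy, rfl⟩
        rw [← sub_add_cancel z ((resD 𝒜 (i + 1)).lTensor N y)]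
        -- Subtracting this boundary cancels the part on basis vectors of degree e and creates none
        -- in higher degree.
        refine Submodule.add_mem _ (ih _ ?_ fun a ha => ?_) hdy
        · rw [mem_torCycles_succ]
          refine ⟨Submodule.sub_mem _ hzc (lTensor_mem_freeChains hsmul _
            (fun a b => resD_single_apply_mem (i + 1) a b) hy), ?_⟩
          rw [map_sub, hz0, lTensor_resD_comp, sub_zero]
        · by_contra hlt
          refine ha ?_
          rw [map_sub, Finsupp.sub_apply, coords_lTensor, LinearEquiv.apply_symm_apply]
          rcases eq_or_ne (resDeg 𝒜 (i + 1) a) e with hae | hae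
          · rw [hrow (i + 1) g hge a hae, hg a hae, hfF a hae, sub_self]
          · have h1 : coords R N _ z a = 0 := by
              by_contra h0
              have := h a h0
              push_cast at this
              omega
            rw [h1, zero_sub, neg_eq_zero]
            refine Finset.sum_eq_zero fun b hb => ?_
            have hbe : resDeg 𝒜 (i + 1 + 1) b = e := by
              by_contra h
              exact (Finsupp.mem_support_iff.1 hb) (hge b h)
            change _ • g b = 0
            rw [hR.eq_zero_of_neg _ (resD_single_apply_mem (i + 1) b a), zero_smul]
            omega
    obtain ⟨m, hm⟩ := ((coords R N _ z).support.image fun a => resDeg 𝒜 (i + 1) a).exists_le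
    refine key (m + 1 - j + D).toNat z hz fun a ha => ?_
    have := hm _ (Finset.mem_image_of_mem _ (Finsupp.mem_support_iff.2 ha))
    omega

/-- If `Tor_0` vanishes in degrees `> r`, then the module is generated in degrees `≤ r`. -/
theorem RegularityLE.mem_pow_smul (hR : IsStandardGraded 𝒜) {𝒩 : ℤ → Submodule K N} {r : ℤ}
    (h : RegularityLE 𝒜 𝒩 r) {j : ℤ} {x : N} (hx : x ∈ 𝒩 j) :
    x ∈ maxIdeal 𝒜 ^ (j - r).toNat • (⊤ : Submodule R N) := by
  have key : ∀ n : ℕ, ∀ j : ℤ, j ≤ r + n → ∀ x ∈ 𝒩 j,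
      x ∈ maxIdeal 𝒜 ^ (j - r).toNat • (⊤ : Submodule R N) := by
    intro n
    induction n with
    | zero =>
      intro j hj x _
      push_cast at hj
      rw [show (j - r).toNat = 0 by omega]
      simp
    | succ n ih =>
      intro j hj x hx
      rcases le_or_gt j r with hjr | hjr
      · rw [show (j - r).toNat = 0 by omega]
        simp
      have hz : x ⊗ₜ[R] Finsupp.single (PUnit.unit : ResIdx 𝒜 0) (1 : R) ∈
          torCycles 𝒜 𝒩 0 j :=
        Submodule.subset_span ⟨PUnit.unit, x, (sub_zero j).symm ▸ hx, rfl⟩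
      -- Every chain in homological degree 0 is a cycle, so x ⊗ 1 is a boundary. This writes x as a
      -- combination, with coefficients in 𝔪, of elements of N of other degrees.
      obtain ⟨y, hy, hyx⟩ := mem_torBoundaries.1 (h 0 j (by push_cast; omega) hz)
      have h1 := congrArg (fun z => coords R N _ z PUnit.unit) hyx
      simp only [coords_lTensor, coords_tmul_single, Finsupp.single_eq_same] at h1
      rw [← h1]
      refine Submodule.sum_mem _ fun a _ => ?_
      have hd := resD_single_apply_mem 0 a PUnit.unit
      have hdm : resD 𝒜 0 (Finsupp.single a 1) PUnit.unit ∈ maxIdeal 𝒜 := by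
        have := (exact_resD_aug 𝒜).apply_apply_eq_zero (Finsupp.single a 1)
        exact (Submodule.Quotient.mk_eq_zero _).1 this
      set d := resDeg 𝒜 1 a with hda
      rw [show resDeg 𝒜 0 PUnit.unit = 0 from rfl, sub_zero] at hd
      -- 𝔪 has no nonzero element of degree ≤ 0, so the remaining terms involve elements of degree j
      -- - d < j.
      rcases le_or_gt d 0 with hd0 | hd0
      · beta_reduce
        rw [hR.eq_zero_of_mem_maxIdeal hd0 hd hdm, zero_smul]
        exact zero_mem _
      have h2 := ih (j - d) (by push_cast at hj; omega) _ (mem_freeChains_iff.1 hy a)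
      have h3 := Submodule.smul_mem_smul (hR.mem_pow hd) h2
      rw [← mul_smul, ← pow_add] at h3
      exact Submodule.smul_mono_left (Ideal.pow_le_pow_right (by omega)) h3
  exact key (j - r).toNat j (by omega) x hx

end KoszulVanishing

/-! ### The exterior algebra: antiderivation, homogeneous pieces, coordinates -/

section ExteriorAlgebra

variable {R : Type u} [CommRing R] {n : ℕ}

/-- Left multiplication by `v` on `⋀F`. -/
def extMul (v : Fin n → R) : Ext R n →ₗ[R] Ext R n :=
  (extEquiv R n).toLinearMap ∘ₗ LinearMap.mulLeft R (ExteriorAlgebra.ι R v) ∘ₗ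
    (extEquiv R n).symm.toLinearMap

theorem extMul_wedge {t : ℕ} (a : Fin n) (b : Fin t → Fin n) :
    extMul (Pi.single a 1) (wedge R b) = wedge R (Fin.cons a b : Fin (t + 1) → Fin n) := by
  simp only [extMul, wedge, LinearMap.comp_apply, LinearEquiv.coe_coe, LinearEquiv.symm_apply_apply,
    LinearMap.mulLeft_apply]
  rw [ExteriorAlgebra.ιMulti_succ_apply]
  rfl

theorem extD_extMul (u : Fin n → R) (v : Fin n → R) (w : Ext R n) :
    extD u (extMul v w) = koszulForm u v • w - extMul v (extD u w) := by
  obtain ⟨w, rfl⟩ := (extEquiv R n).surjective w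
  simp only [extMul, extD, LinearMap.comp_apply, LinearEquiv.coe_coe, LinearEquiv.symm_apply_apply,
    LinearMap.mulLeft_apply]
  refine (congrArg _ (CliffordAlgebra.contractLeft_ι_mul (Q := (0 : QuadraticForm R (Fin n → R)))
    (d := koszulForm u) v w)).trans ?_
  rw [map_sub, map_smul]

theorem extD_extD (u : Fin n → R) (w : Ext R n) : extD u (extD u w) = 0 := by
  simp only [extD, LinearMap.comp_apply, LinearEquiv.coe_coe, LinearEquiv.symm_apply_apply]
  rw [CliffordAlgebra.contractLeft_contractLeft, map_zero]

theorem extMul_mem_extPower (v : Fin n → R) {t : ℕ} {w : Ext R n} (hw : w ∈ extPower R n t) :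
    extMul v w ∈ extPower R n (t + 1) := by
  obtain ⟨w, hw, rfl⟩ := hw
  refine ⟨ExteriorAlgebra.ι R v * w, ?_, rfl⟩
  change _ ∈ LinearMap.range (ExteriorAlgebra.ι R) ^ (t + 1)
  rw [pow_succ']
  exact Submodule.mul_mem_mul ⟨v, rfl⟩ hw

theorem extD_eq_zero_of_mem_extPower_zero {w : Ext R n} (hw : w ∈ extPower R n 0) (u : Fin n → R) :
    extD u w = 0 := by
  obtain ⟨w, hw, rfl⟩ := hw
  change w ∈ LinearMap.range (ExteriorAlgebra.ι R) ^ 0 at hw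
  rw [pow_zero, Submodule.mem_one] at hw
  obtain ⟨r, rfl⟩ := hw
  exact (congrArg (extEquiv R n) (CliffordAlgebra.contractLeft_algebraMap
    (Q := (0 : QuadraticForm R (Fin n → R))) (koszulForm u) r)).trans (map_zero _)

/-- ⋀^(t+1) F is spanned by products of F with ⋀^t F, which matches the antiderivation formula
`extD_extMul`. -/
theorem extPower_succ_induction {t : ℕ} {p : Ext R n → Prop} {w : Ext R n}
    (hw : w ∈ extPower R n (t + 1)) (hadd : ∀ x y, p x → p y → p (x + y))
    (hmul : ∀ v, ∀ x ∈ extPower R n t, p (extMul v x)) : p w := by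
  obtain ⟨w, hw, rfl⟩ := hw
  change w ∈ LinearMap.range (ExteriorAlgebra.ι R) ^ (t + 1) at hw
  rw [pow_succ'] at hw
  refine Submodule.mul_induction_on hw ?_ ?_
  · rintro _ ⟨v, rfl⟩ x hx
    exact hmul v _ ⟨x, hx, rfl⟩
  · intro x y hx hy
    rw [map_add]
    exact hadd _ _ hx hy

theorem extD_mem_extPower (u : Fin n → R) {t : ℕ} {w : Ext R n} (hw : w ∈ extPower R n (t + 1)) :
    extD u w ∈ extPower R n t := by
  induction t generalizing w with
  | zero =>
    refine extPower_succ_induction (p := fun w => extD u w ∈ _) hw (fun x y hx hy => ?_) fun v x hx => ?_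
    · rw [map_add]; exact add_mem hx hy
    · rw [extD_extMul, extD_eq_zero_of_mem_extPower_zero hx, map_zero, sub_zero]
      exact Submodule.smul_mem _ _ hx
  | succ t ih =>
    refine extPower_succ_induction (p := fun w => extD u w ∈ _) hw (fun x y hx hy => ?_) fun v x hx => ?_
    · rw [map_add]; exact add_mem hx hy
    · rw [extD_extMul]
      exact sub_mem (Submodule.smul_mem _ _ hx) (extMul_mem_extPower v (ih hx))

theorem wedge_mem_extPower {t : ℕ} (a : Fin t → Fin n) : wedge R a ∈ extPower R n t :=
  ⟨_, ExteriorAlgebra.ιMulti_range R t ⟨_, rfl⟩, rfl⟩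

/-- The increasing enumeration of a `t`-subset. -/
abbrev enum {t : ℕ} (s : Set.powersetCard (Fin n) t) : Fin t → Fin n :=
  Set.powersetCard.ofFinEmbEquiv.symm s

/-- The coordinate form on `⋀F` of the basis element given by a `t`-subset. -/
def wedgeCoord (R : Type u) [CommRing R] {n t : ℕ} (s : Set.powersetCard (Fin n) t) :
    Ext R n →ₗ[R] R :=
  ExteriorAlgebra.liftAlternating (Pi.single t
    ((exteriorPower.ιMultiDual R t (Pi.basisFun R (Fin n)) s).compAlternatingMap
      (exteriorPower.ιMulti R t))) ∘ₗ (extEquiv R n).symm.toLinearMap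

theorem wedgeCoord_wedge_of_ne {t t' : ℕ} (h : t' ≠ t) (s : Set.powersetCard (Fin n) t)
    (a : Fin t' → Fin n) : wedgeCoord R s (wedge R a) = 0 := by
  simp only [wedgeCoord, wedge, LinearMap.comp_apply, LinearEquiv.coe_coe,
    LinearEquiv.symm_apply_apply]
  rw [ExteriorAlgebra.liftAlternating_apply_ιMulti, Pi.single_eq_of_ne h]
  rfl

/-- A 0-1 determinant covers repeated or unordered indices, which the spanning set of
`koszulGrading` allows. -/
theorem wedgeCoord_wedge {t : ℕ} (s : Set.powersetCard (Fin n) t) (a : Fin t → Fin n) :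
    wedgeCoord R s (wedge R a) =
      (Matrix.of fun i j => if a i = enum s j then (1 : R) else 0).det := by
  simp only [wedgeCoord, wedge, LinearMap.comp_apply, LinearEquiv.coe_coe,
    LinearEquiv.symm_apply_apply]
  rw [ExteriorAlgebra.liftAlternating_apply_ιMulti, Pi.single_eq_same,
    LinearMap.compAlternatingMap_apply, exteriorPower.ιMultiDual_apply_ιMulti]
  congr 1
  ext i j
  simp [Pi.single_apply, eq_comm]

theorem wedgeCoord_extEquiv {t : ℕ} (s : Set.powersetCard (Fin n) t) (w : ⋀[R]^t (Fin n → R)) :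
    wedgeCoord R s (extEquiv R n w) =
      exteriorPower.ιMultiDual R t (Pi.basisFun R (Fin n)) s w := by
  have : wedgeCoord R s ∘ₗ (extEquiv R n).toLinearMap ∘ₗ (⋀[R]^t (Fin n → R)).subtype =
      exteriorPower.ιMultiDual R t (Pi.basisFun R (Fin n)) s := by
    refine exteriorPower.linearMap_ext ?_
    ext v
    simp only [wedgeCoord, LinearMap.compAlternatingMap_apply, LinearMap.comp_apply,
      LinearEquiv.coe_coe, LinearEquiv.symm_apply_apply, Submodule.subtype_apply,
      exteriorPower.ιMulti_apply_coe]
    rw [ExteriorAlgebra.liftAlternating_apply_ιMulti, Pi.single_eq_same,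
      LinearMap.compAlternatingMap_apply]
  exact LinearMap.congr_fun this w

theorem sum_wedgeCoord_smul {t : ℕ} {w : Ext R n} (hw : w ∈ extPower R n t) :
    ∑ s : Set.powersetCard (Fin n) t, wedgeCoord R s w • wedge R (enum s) = w := by
  obtain ⟨w, hw, rfl⟩ := hw
  lift w to ⋀[R]^t (Fin n → R) using hw
  have h : ∀ s, ((exteriorPower.ιMulti_family R t (Pi.basisFun R (Fin n)) s : ⋀[R]^t (Fin n → R)) :
      ExteriorAlgebra R (Fin n → R)) =
      ExteriorAlgebra.ιMulti R t fun k => (Pi.single (enum s k) 1 : Fin n → R) := by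
    intro s
    rw [exteriorPower.ιMulti_family_apply_coe, ExteriorAlgebra.ιMulti_family]
    congr 1
    ext k
    simp [Pi.basisFun_apply]
  have h1 := ((Pi.basisFun R (Fin n)).exteriorPower t).sum_repr w
  have h2 := congrArg ((extEquiv R n).toLinearMap ∘ₗ (⋀[R]^t (Fin n → R)).subtype) h1
  rw [map_sum] at h2
  refine Eq.trans (Finset.sum_congr rfl fun s _ => ?_) h2
  rw [map_smul, exteriorPower.basis_repr_apply, exteriorPower.basis_apply, LinearEquiv.coe_coe,
    wedgeCoord_extEquiv, LinearMap.comp_apply, Submodule.subtype_apply, h]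
  rfl

end ExteriorAlgebra

/-! ### The Koszul complex with coefficients and its grading -/

section KoszulComplex

variable {R : Type u} [CommRing R] {n : ℕ} {M : Type v} [AddCommGroup M] [Module R M]

theorem lTensor_mem_koszulChains {g : Ext R n →ₗ[R] Ext R n} {t t' : ℕ}
    (hg : ∀ w ∈ extPower R n t, g w ∈ extPower R n t') {z : M ⊗[R] Ext R n}
    (hz : z ∈ koszulChains R n M t) : g.lTensor M z ∈ koszulChains R n M t' := by
  obtain ⟨y, rfl⟩ := hz
  refine ⟨(g.restrict hg).lTensor M y, ?_⟩
  rw [← LinearMap.comp_apply, ← LinearMap.comp_apply, ← LinearMap.lTensor_comp,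
    ← LinearMap.lTensor_comp]
  rfl

theorem tmul_mem_koszulChains {t : ℕ} (x : M) {w : Ext R n} (hw : w ∈ extPower R n t) :
    x ⊗ₜ[R] w ∈ koszulChains R n M t :=
  ⟨x ⊗ₜ ⟨w, hw⟩, rfl⟩

theorem koszulD_mem_koszulChains (u : Fin n → R) {t : ℕ} {z : M ⊗[R] Ext R n}
    (hz : z ∈ koszulChains R n M (t + 1)) : koszulD u M z ∈ koszulChains R n M t :=
  lTensor_mem_koszulChains (fun _ hw => extD_mem_extPower u hw) hz

theorem koszulD_koszulD (u : Fin n → R) (z : M ⊗[R] Ext R n) :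
    koszulD u M (koszulD u M z) = 0 := by
  have : extD u ∘ₗ extD u = 0 := LinearMap.ext (extD_extD u)
  rw [koszulD, ← LinearMap.comp_apply, ← LinearMap.lTensor_comp, this]
  simp

theorem koszulD_zero (u : Fin n → R) {z : M ⊗[R] Ext R n}
    (hz : z ∈ koszulChains R n M 0) : koszulD u M z = 0 := by
  obtain ⟨y, rfl⟩ := hz
  have : extD u ∘ₗ (extPower R n 0).subtype = 0 :=
    LinearMap.ext fun w => extD_eq_zero_of_mem_extPower_zero w.2 u
  rw [koszulD, ← LinearMap.comp_apply, ← LinearMap.lTensor_comp, this]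
  simp

theorem koszulBoundaries_le_koszulCycles (u : Fin n → R) (t : ℕ) :
    koszulBoundaries u M t ≤ koszulCycles u M t := by
  rintro _ ⟨z, hz, rfl⟩
  exact ⟨koszulD_mem_koszulChains u hz, koszulD_koszulD u z⟩

theorem koszulCycles_zero (u : Fin n → R) : koszulCycles u M 0 = koszulChains R n M 0 :=
  inf_eq_left.2 fun _ hz => koszulD_zero u hz

/-- Wedge multiplication by `v` is a homotopy between `0` and multiplication by `φ v`. -/
theorem koszulD_extMul (u v : Fin n → R) (z : M ⊗[R] Ext R n) :
    koszulD u M ((extMul v).lTensor M z) =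
      koszulForm u v • z - (extMul v).lTensor M (koszulD u M z) := by
  induction z using TensorProduct.induction_on with
  | zero => simp
  | tmul x w =>
    simp only [koszulD, LinearMap.lTensor_tmul, extD_extMul, TensorProduct.tmul_sub,
      TensorProduct.tmul_smul]
  | add x y hx hy =>
    simp only [map_add, hx, hy, smul_add]
    abel

/-- For a cycle z the homotopy reduces to φ(v) z = d(v ∧ z), and an element of Ann M already kills M
⊗ ⋀F. -/
theorem smul_mem_koszulBoundaries {u : Fin n → R} {t : ℕ} {r : R}
    (hr : r ∈ LinearMap.range (koszulForm u) ⊔ Module.annihilator R M) {z : M ⊗[R] Ext R n}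
    (hz : z ∈ koszulCycles u M t) : r • z ∈ koszulBoundaries u M t := by
  obtain ⟨_, ⟨v, rfl⟩, s, hs, rfl⟩ := Submodule.mem_sup.1 hr
  rw [add_smul]
  refine add_mem ⟨(extMul v).lTensor M z,
    lTensor_mem_koszulChains (fun w hw => extMul_mem_extPower v hw) hz.1, ?_⟩ ?_
  · rw [koszulD_extMul, (show koszulD u M z = 0 from hz.2), map_zero, sub_zero]
  · have : s • z = 0 := by
      clear hz
      induction z using TensorProduct.induction_on with
      | zero => simp
      | tmul x w =>
        rw [TensorProduct.smul_tmul', Module.mem_annihilator.1 hs x, TensorProduct.zero_tmul]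
      | add x y hx hy => rw [smul_add, hx, hy, add_zero]
    rw [this]
    exact zero_mem _

/-- The coordinate map `M ⊗ ⋀F → M` of a basis element. -/
def coordMap (M : Type v) [AddCommGroup M] [Module R M] {t : ℕ}
    (s : Set.powersetCard (Fin n) t) : M ⊗[R] Ext R n →ₗ[R] M :=
  (TensorProduct.rid R M).toLinearMap ∘ₗ (wedgeCoord R s).lTensor M

theorem coordMap_tmul {t : ℕ} (s : Set.powersetCard (Fin n) t) (x : M) (w : Ext R n) :
    coordMap M s (x ⊗ₜ w) = wedgeCoord R s w • x := by
  simp [coordMap]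

/-- The inclusion `M → M ⊗ ⋀F` of a summand. -/
def inclMap (M : Type v) [AddCommGroup M] [Module R M] {t : ℕ}
    (s : Set.powersetCard (Fin n) t) : M →ₗ[R] M ⊗[R] Ext R n :=
  (TensorProduct.mk R M (Ext R n)).flip (wedge R (enum s))

theorem inclMap_apply {t : ℕ} (s : Set.powersetCard (Fin n) t) (x : M) :
    inclMap M s x = x ⊗ₜ[R] wedge R (enum s) := rfl

theorem inclMap_mem {t : ℕ} (s : Set.powersetCard (Fin n) t) (x : M) :
    inclMap M s x ∈ koszulChains R n M t :=
  tmul_mem_koszulChains x (wedge_mem_extPower _)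

theorem sum_inclMap_coordMap {t : ℕ} {z : M ⊗[R] Ext R n} (hz : z ∈ koszulChains R n M t) :
    ∑ s : Set.powersetCard (Fin n) t, inclMap M s (coordMap M s z) = z := by
  obtain ⟨y, rfl⟩ := hz
  induction y using TensorProduct.induction_on with
  | zero => simp
  | tmul x w =>
    simp only [LinearMap.lTensor_tmul, coordMap_tmul, inclMap_apply, TensorProduct.smul_tmul,
      Submodule.subtype_apply]
    rw [← TensorProduct.tmul_sum, sum_wedgeCoord_smul w.2]
  | add x y hx hy =>
    simp only [map_add, Finset.sum_add_distrib, hx, hy]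

variable {K : Type w} [Field K] [Algebra K R] [Module K M] [IsScalarTower K R M]
  {d : Fin n → ℤ} {ℳ : ℤ → Submodule K M}

theorem tmul_wedge_mem {t : ℕ} (a : Fin t → Fin n) {i : ℤ} {x : M} (hx : x ∈ ℳ i) :
    x ⊗ₜ[R] wedge R a ∈ koszulGrading d ℳ (i + ∑ k, d (a k)) :=
  Submodule.subset_span ⟨t, a, x, by rwa [add_sub_cancel_right], rfl⟩

/-- The map `f` sends the component of degree `j` into `p` if it does so on the generators. -/
theorem koszulGrading_induction {N : Type*} [AddCommGroup N] [Module R N] [Module K N]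
    [IsScalarTower K R N] {P : Submodule K N} (f : M ⊗[R] Ext R n →ₗ[R] N) {j : ℤ}
    (h : ∀ (t : ℕ) (a : Fin t → Fin n), ∀ x ∈ ℳ (j - ∑ k, d (a k)), f (x ⊗ₜ wedge R a) ∈ P)
    {z : M ⊗[R] Ext R n} (hz : z ∈ koszulGrading d ℳ j) : f z ∈ P := by
  have : koszulGrading d ℳ j ≤ P.comap (f.restrictScalars K) := by
    refine Submodule.span_le.2 ?_
    rintro _ ⟨t, a, x, hx, rfl⟩
    exact h t a x hx
  exact this hz

theorem coordMap_mem {t : ℕ} (s : Set.powersetCard (Fin n) t) {j : ℤ} {z : M ⊗[R] Ext R n}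
    (hz : z ∈ koszulGrading d ℳ j) : coordMap M s z ∈ ℳ (j - ∑ k, d (enum s k)) := by
  refine koszulGrading_induction _ (fun t' a x hx => ?_) hz
  rw [coordMap_tmul]
  by_cases ht : t' = t
  · subst ht
    -- The coordinate is the image of a determinant over K. If it is nonzero, some permutation
    -- carries `a` to the increasing enumeration, so both have the same total degree.
    let A : Matrix (Fin t') (Fin t') K := Matrix.of fun i j => if a i = enum s j then (1 : K) else 0
    have hA : wedgeCoord R s (wedge R a) = algebraMap K R A.det := by
      rw [wedgeCoord_wedge, RingHom.map_det]
      congr 1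
      ext i j
      simp [A, apply_ite (algebraMap K R)]
    rw [hA, algebraMap_smul]
    by_cases hdet : A.det = 0
    · rw [hdet, zero_smul]; exact zero_mem _
    · rw [Matrix.det_apply] at hdet
      obtain ⟨σ, -, hσ⟩ := Finset.exists_ne_zero_of_sum_ne_zero hdet
      have hσ' : ∀ i, a (σ i) = enum s i := by
        intro i
        by_contra hne
        refine hσ ?_
        rw [Finset.prod_eq_zero (Finset.mem_univ i) (by simp [A, hne]), smul_zero]
      have : ∑ k, d (enum s k) = ∑ k, d (a k) := by
        rw [← Equiv.sum_comp σ fun k => d (a k)]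
        exact Finset.sum_congr rfl fun i _ => by rw [hσ']
      rw [this]
      exact Submodule.smul_mem _ _ hx
  · rw [wedgeCoord_wedge_of_ne ht, zero_smul]
    exact zero_mem _

theorem smul_mem_koszulGrading {𝒜 : ℤ → Submodule K R}
    (hsmul : ∀ i j r x, r ∈ 𝒜 i → x ∈ ℳ j → r • x ∈ ℳ (i + j)) (i j : ℤ) (r : R)
    (z : M ⊗[R] Ext R n) (hr : r ∈ 𝒜 i) (hz : z ∈ koszulGrading d ℳ j) :
    r • z ∈ koszulGrading d ℳ (i + j) := by
  refine koszulGrading_induction (LinearMap.lsmul R (M ⊗[R] Ext R n) r) (fun t a x hx => ?_) hz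
  have := tmul_wedge_mem (R := R) (d := d) a (hsmul _ _ _ _ hr hx)
  rwa [show i + (j - ∑ k, d (a k)) + ∑ k, d (a k) = i + j by ring] at this

theorem extMul_mem_koszulGrading (a : Fin n) {j : ℤ} {z : M ⊗[R] Ext R n}
    (hz : z ∈ koszulGrading d ℳ j) :
    (extMul (Pi.single a 1)).lTensor M z ∈ koszulGrading d ℳ (j + d a) := by
  refine koszulGrading_induction _ (fun t b x hx => ?_) hz
  rw [LinearMap.lTensor_tmul, extMul_wedge]
  have := tmul_wedge_mem (R := R) (d := d) (Fin.cons a b : Fin (t + 1) → Fin n) hx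
  rw [Fin.sum_univ_succ] at this
  simp only [Fin.cons_zero, Fin.cons_succ] at this
  rwa [show j - ∑ k, d (b k) + (d a + ∑ k, d (b k)) = j + d a by ring] at this

/-- Peel off the first factor of a wedge: both terms of the antiderivation formula keep the degree,
as u_a has the degree of e_a. -/
theorem koszulD_mem_koszulGrading {𝒜 : ℤ → Submodule K R}
    (hsmul : ∀ i j r x, r ∈ 𝒜 i → x ∈ ℳ j → r • x ∈ ℳ (i + j)) {u : Fin n → R}
    (hu : ∀ a, u a ∈ 𝒜 (d a)) {j : ℤ} {z : M ⊗[R] Ext R n} (hz : z ∈ koszulGrading d ℳ j) :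
    koszulD u M z ∈ koszulGrading d ℳ j := by
  have key : ∀ (t : ℕ) (a : Fin t → Fin n) (i : ℤ), ∀ x ∈ ℳ i,
      koszulD u M (x ⊗ₜ wedge R a) ∈ koszulGrading d ℳ (i + ∑ k, d (a k)) := by
    intro t
    induction t with
    | zero =>
      intro a i x _
      rw [koszulD_zero u (tmul_mem_koszulChains x (wedge_mem_extPower a))]
      exact zero_mem _
    | succ t ih =>
      intro a i x hx
      have h1 : x ⊗ₜ[R] wedge R a =
          (extMul (Pi.single (a 0) 1)).lTensor M (x ⊗ₜ[R] wedge R (Fin.tail a)) := by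
        rw [LinearMap.lTensor_tmul, extMul_wedge, Fin.cons_self_tail]
      have h2 : koszulForm u (Pi.single (a 0) 1) = u (a 0) := by
        simp [koszulForm, Fintype.linearCombination_apply_single]
      rw [h1, koszulD_extMul, h2, Fin.sum_univ_succ]
      refine sub_mem ?_ ?_
      · have h3 := smul_mem_koszulGrading hsmul _ _ _ _ (hu (a 0))
          (tmul_wedge_mem (R := R) (d := d) (Fin.tail a) hx)
        rwa [show d (a 0) + (i + ∑ k, d (Fin.tail a k)) = i + (d (a 0) + ∑ k, d (Fin.tail a k)) by
          ring] at h3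
      · have h3 := extMul_mem_koszulGrading (a 0) (ih (Fin.tail a) i x hx)
        rwa [show i + ∑ k, d (Fin.tail a k) + d (a 0) = i + (d (a 0) + ∑ k, d (Fin.tail a k)) by
          ring] at h3
  refine koszulGrading_induction _ (fun t a x hx => ?_) hz
  have := key t a _ x hx
  rwa [sub_add_cancel] at this

/-- A homogeneous boundary is the boundary of a homogeneous chain. -/
theorem exists_koszulD_eq [DirectSum.Decomposition ℳ] {𝒜 : ℤ → Submodule K R}
    (hsmul : ∀ i j r x, r ∈ 𝒜 i → x ∈ ℳ j → r • x ∈ ℳ (i + j)) {u : Fin n → R}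
    (hu : ∀ a, u a ∈ 𝒜 (d a)) {t : ℕ} {j : ℤ} {b : M ⊗[R] Ext R n}
    (hb : b ∈ koszulBoundaries u M t) (hbj : b ∈ koszulGrading d ℳ j) :
    ∃ k ∈ koszulChains R n M (t + 1), k ∈ koszulGrading d ℳ j ∧ koszulD u M k = b := by
  -- `π` projects K_t onto degree j through the coordinates, avoiding a full decomposition of M ⊗
  -- ⋀F. Applied to a boundary, it keeps the differentials of the chain's pieces of degree j.
  let π : M ⊗[R] Ext R n →+ M ⊗[R] Ext R n :=
    ∑ s : Set.powersetCard (Fin n) t, (inclMap M s).toAddMonoidHom.comp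
      (((ℳ (j - ∑ k, d (enum s k))).subtype.toAddMonoidHom.comp
        ((DFinsupp.evalAddMonoidHom (j - ∑ k, d (enum s k))).comp
          (DirectSum.decomposeAddEquiv ℳ).toAddMonoidHom)).comp (coordMap M s).toAddMonoidHom)
  have hπ : ∀ z, π z = ∑ s : Set.powersetCard (Fin n) t, inclMap M s
      (DirectSum.decompose ℳ (coordMap M s z) (j - ∑ k, d (enum s k)) : M) := by
    intro z
    simp only [π, AddMonoidHom.finsetSum_apply]
    rfl
  have hπ_same : ∀ z ∈ koszulChains R n M t, z ∈ koszulGrading d ℳ j → π z = z := by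
    intro z hz hzj
    rw [hπ]
    refine Eq.trans (Finset.sum_congr rfl fun s _ => ?_) (sum_inclMap_coordMap hz)
    rw [DirectSum.decompose_of_mem_same ℳ (coordMap_mem s hzj)]
  have hπ_ne : ∀ i, i ≠ j → ∀ z ∈ koszulGrading d ℳ i, π z = 0 := by
    intro i hij z hz
    rw [hπ]
    refine Finset.sum_eq_zero fun s _ => ?_
    rw [DirectSum.decompose_of_mem_ne ℳ (coordMap_mem s hz) (fun h => hij (by omega)), map_zero]
  have key : ∀ k ∈ koszulChains R n M (t + 1), ∃ k' ∈ koszulChains R n M (t + 1),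
      k' ∈ koszulGrading d ℳ j ∧ koszulD u M k' = π (koszulD u M k) := by
    have hadd : ∀ x y, (∃ k' ∈ koszulChains R n M (t + 1),
        k' ∈ koszulGrading d ℳ j ∧ koszulD u M k' = π (koszulD u M x)) →
        (∃ k' ∈ koszulChains R n M (t + 1),
        k' ∈ koszulGrading d ℳ j ∧ koszulD u M k' = π (koszulD u M y)) →
        ∃ k' ∈ koszulChains R n M (t + 1),
        k' ∈ koszulGrading d ℳ j ∧ koszulD u M k' = π (koszulD u M (x + y)) := by
      rintro x y ⟨a, ha, haj, hax⟩ ⟨b, hb, hbj, hby⟩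
      exact ⟨a + b, add_mem ha hb, add_mem haj hbj, by rw [map_add, map_add, map_add, hax, hby]⟩
    have hzero : ∃ k' ∈ koszulChains R n M (t + 1),
        k' ∈ koszulGrading d ℳ j ∧ koszulD u M k' = π (koszulD u M 0) :=
      ⟨0, zero_mem _, zero_mem _, by simp⟩
    intro k hk
    rw [← sum_inclMap_coordMap hk]
    refine Finset.sum_induction _ (fun x => ∃ k' ∈ koszulChains R n M (t + 1),
        k' ∈ koszulGrading d ℳ j ∧ koszulD u M k' = π (koszulD u M x)) hadd hzero fun s _ => ?_
    generalize coordMap M s k = x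
    induction x using DirectSum.Decomposition.inductionOn ℳ with
    | zero => rw [map_zero]; exact hzero
    | @homogeneous i x =>
      have h1 := tmul_wedge_mem (R := R) (d := d) (enum s) x.2
      by_cases hij : i + ∑ k, d (enum s k) = j
      · rw [hij] at h1
        refine ⟨_, inclMap_mem s x.1, h1, (hπ_same _ ?_ ?_).symm⟩
        · exact koszulD_mem_koszulChains u (inclMap_mem s x.1)
        · exact koszulD_mem_koszulGrading hsmul hu h1
      · refine ⟨0, zero_mem _, zero_mem _, ?_⟩
        rw [map_zero, inclMap_apply, hπ_ne _ hij _ (koszulD_mem_koszulGrading hsmul hu h1)]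
    | add x y hx hy => rw [map_add]; exact hadd _ _ hx hy
  obtain ⟨k, hk, rfl⟩ := hb
  obtain ⟨k', hk', hkj, h⟩ := key k hk
  refine ⟨k', hk', hkj, ?_⟩
  rw [h, hπ_same _ (koszulD_mem_koszulChains u hk) hbj]

/-- The grading of a submodule of `M ⊗ ⋀F`. -/
def subGrading (d : Fin n → ℤ) (ℳ : ℤ → Submodule K M) (Q : Submodule R (M ⊗[R] Ext R n))
    (j : ℤ) : Submodule K Q :=
  (koszulGrading d ℳ j).comap (Q.subtype.restrictScalars K)

theorem mem_subGrading {Q : Submodule R (M ⊗[R] Ext R n)} {j : ℤ} {z : Q} :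
    z ∈ subGrading d ℳ Q j ↔ (z : M ⊗[R] Ext R n) ∈ koszulGrading d ℳ j := Iff.rfl

theorem smul_mem_subGrading {𝒜 : ℤ → Submodule K R}
    (hsmul : ∀ i j r x, r ∈ 𝒜 i → x ∈ ℳ j → r • x ∈ ℳ (i + j))
    {Q : Submodule R (M ⊗[R] Ext R n)} (i j : ℤ) (r : R) (z : Q) (hr : r ∈ 𝒜 i)
    (hz : z ∈ subGrading d ℳ Q j) : r • z ∈ subGrading d ℳ Q (i + j) :=
  mem_subGrading.2 (smul_mem_koszulGrading hsmul i j r z.1 hr (mem_subGrading.1 hz))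

/-- K_t is a finite direct sum of copies of M, each shifted by a sum of t of the degrees `d a`. -/
theorem regularityLE_koszulChains {𝒜 : ℤ → Submodule K R} {r : ℤ} (hM : RegularityLE 𝒜 ℳ r)
    {c : ℤ} (hd : ∀ a, d a ≤ c) (t : ℕ) :
    RegularityLE 𝒜 (subGrading d ℳ (koszulChains R n M t)) (r + t * c) := by
  refine RegularityLE.of_retract (β := Set.powersetCard (Fin n) t)
    (fun s => ∑ k, d (enum s k)) (fun s => coordMap M s ∘ₗ (koszulChains R n M t).subtype)
    (fun s => (inclMap M s).codRestrict _ (inclMap_mem s)) (fun s j x hx => coordMap_mem s hx)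
    (fun s j x hx => tmul_wedge_mem _ hx) (fun x => Subtype.ext ?_) hM fun s => ?_
  · rw [Submodule.coe_sum]
    exact sum_inclMap_coordMap x.2
  · have := Finset.sum_le_card_nsmul Finset.univ (fun k => d (enum s k)) c fun k _ => hd _
    rw [Finset.card_univ, Fintype.card_fin, nsmul_eq_mul] at this
    exact add_le_add_right this r

end KoszulComplex

/-! ### Bounds for cycles and homology; degrees of minimal generators -/

section Bound

variable {K : Type w} {R : Type u} [Field K] [CommRing R] [Algebra K R]
  {𝒜 : ℤ → Submodule K R} [GradedAlgebra 𝒜] {n : ℕ} {M : Type v} [AddCommGroup M] [Module R M]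
  [Module K M] [IsScalarTower K R M] {d : Fin n → ℤ} {ℳ : ℤ → Submodule K M}

/-- Elements of `I + Ann M` kill Koszul homology. -/
theorem smul_koszulHomology_eq_zero {u : Fin n → R} {t : ℕ} {r : R}
    (hr : r ∈ LinearMap.range (koszulForm u) ⊔ Module.annihilator R M)
    (z : koszulCycles u M t) :
    r • z ∈ (koszulBoundaries u M t).submoduleOf (koszulCycles u M t) :=
  smul_mem_koszulBoundaries hr z.2

/-- In degrees at least r + c a cycle lies in 𝔪^c Z_t, which consists of boundaries. Thus H_t has
top degree at most r + c - 1, and Koszulness turns this into a bound on regularity. -/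
theorem regularityLE_homology [Nontrivial R] (hR : IsStandardGraded 𝒜)
    (hK : RegularityLE 𝒜 (residueGrading 𝒜) 0)
    (hsmul : ∀ i j r x, r ∈ 𝒜 i → x ∈ ℳ j → r • x ∈ ℳ (i + j)) {u : Fin n → R} {c : ℕ}
    (hc : maxIdeal 𝒜 ^ c ≤ LinearMap.range (koszulForm u) ⊔ Module.annihilator R M)
    {t : ℕ} {r : ℤ} (h : RegularityLE 𝒜 (cyclesGrading u d ℳ t) r) :
    RegularityLE 𝒜 (homologyGrading u d ℳ t) (r + c - 1) := by
  refine regularityLE_of_forall_gt hR hK ?_ ?_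
  · rintro i j a _ ha ⟨z, hz, rfl⟩
    exact ⟨a • z, smul_mem_subGrading hsmul i j a z ha hz, rfl⟩
  · rintro j hj _ ⟨z, hz, rfl⟩
    have h1 := h.mem_pow_smul hR hz
    have h2 := (Ideal.pow_le_pow_right (by omega : c ≤ (j - r).toNat)).trans hc
    have h3 : maxIdeal 𝒜 ^ (j - r).toNat • (⊤ : Submodule R (koszulCycles u M t)) ≤
        (koszulBoundaries u M t).submoduleOf (koszulCycles u M t) :=
      Submodule.smul_le.2 fun a ha z _ => smul_koszulHomology_eq_zero (h2 ha) z
    exact (Submodule.Quotient.mk_eq_zero _).2 (h3 h1)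

/-- Passing from Z_t to H_t costs c - 1, from H_t to B_t one more, and from B_t to Z_{t+1} another
one: c + 1 in total, dominating the growth c of the chains. -/
theorem regularityLE_cycles [Nontrivial R] (hR : IsStandardGraded 𝒜)
    (hK : RegularityLE 𝒜 (residueGrading 𝒜) 0) [DirectSum.Decomposition ℳ]
    (hsmul : ∀ i j r x, r ∈ 𝒜 i → x ∈ ℳ j → r • x ∈ ℳ (i + j)) {u : Fin n → R}
    (hu : ∀ a, u a ∈ 𝒜 (d a)) {c : ℕ} (hd : ∀ a, d a ≤ c)
    (hc : maxIdeal 𝒜 ^ c ≤ LinearMap.range (koszulForm u) ⊔ Module.annihilator R M)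
    {r : ℤ} (hM : RegularityLE 𝒜 ℳ r) (t : ℕ) :
    RegularityLE 𝒜 (cyclesGrading u d ℳ t) (t * (c + 1) + r) := by
  induction t with
  | zero =>
    have h := regularityLE_koszulChains (d := d) hM hd 0
    rw [← koszulCycles_zero u, Nat.cast_zero, zero_mul, add_zero] at h
    rw [Nat.cast_zero, zero_mul, zero_add]
    exact h
  | succ t ih =>
    have hH := regularityLE_homology hR hK hsmul hc ih
    have hB : RegularityLE 𝒜 (subGrading d ℳ (koszulBoundaries u M t))
        (t * (c + 1) + r + c) := by
      refine RegularityLE.of_exact (ℒ := cyclesGrading u d ℳ t) (𝒬 := homologyGrading u d ℳ t)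
        (smul_mem_subGrading hsmul)
        (Submodule.inclusion (koszulBoundaries_le_koszulCycles u t))
        (Submodule.mkQ _) (Submodule.inclusion_injective _) (fun j x hx => hx)
        (fun j x hx => ⟨x, hx, rfl⟩) (fun x => ?_) (fun j x hx hx0 => ?_)
        (fun j x hx => hx) ih hH (by omega) (by omega)
      · exact (Submodule.Quotient.mk_eq_zero _).2 x.2
      · have h1 : x ∈ (koszulBoundaries u M t).submoduleOf (koszulCycles u M t) :=
          (Submodule.Quotient.mk_eq_zero _).1 hx0
        exact ⟨⟨x.1, h1⟩, hx, rfl⟩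
    have hKt := regularityLE_koszulChains (d := d) hM hd (t + 1)
    let D : koszulChains R n M (t + 1) →ₗ[R] koszulBoundaries u M t :=
      (koszulD u M).restrict fun z hz => ⟨z, hz, rfl⟩
    refine RegularityLE.of_exact (ℒ := subGrading d ℳ (koszulChains R n M (t + 1)))
      (𝒬 := subGrading d ℳ (koszulBoundaries u M t)) (smul_mem_subGrading hsmul)
      (Submodule.inclusion (inf_le_left : koszulCycles u M (t + 1) ≤ _)) D (Submodule.inclusion_injective _) (fun j x hx => hx)
      (fun j x hx => koszulD_mem_koszulGrading hsmul hu hx) (fun x => Subtype.ext x.2.2)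
      (fun j x hx hx0 => ⟨⟨x.1, x.2, congrArg Subtype.val hx0⟩, hx, rfl⟩) (fun j x hx => ?_)
      hKt hB ?_ ?_
    · obtain ⟨k, hk, hkj, hkx⟩ := exists_koszulD_eq hsmul hu x.2 hx
      exact ⟨⟨k, hk⟩, hkj, Subtype.ext hkx⟩
    · have : (0 : ℤ) ≤ t := Nat.cast_nonneg t
      push_cast
      nlinarith
    · push_cast
      nlinarith

/-- The degrees of minimal generators are bounded by any generating degree. -/
theorem degree_le_of_isMinimalPresentation [Nontrivial R] (hR : IsStandardGraded 𝒜) {I : Ideal R}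
    {u : Fin n → R} (h : IsMinimalPresentation 𝒜 I u d) {c : ℤ}
    (hc : GeneratedInDegreeLE 𝒜 I c) (a : Fin n) : d a ≤ c := by
  classical
  by_contra hlt
  rw [not_le] at hlt
  -- If d a > c, the elements of I of degree ≤ c need no multiple of u_a, its coefficient having
  -- negative degree. So u_a is a combination of the others, giving a relation with coefficient 1 at
  -- a, outside 𝔪.
  let J : Submodule R (Fin n → R) := LinearMap.ker (LinearMap.proj (φ := fun _ : Fin n => R) a)
  have h1 : I ≤ J.map (koszulForm u) := by
    rw [hc]
    refine Ideal.span_le.2 ?_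
    rintro x ⟨hxI, i, hic, hx⟩
    rw [← h.range_eq] at hxI
    obtain ⟨v, rfl⟩ := hxI
    have hsum : ∀ w : Fin n → R, koszulForm u w = ∑ b, w b * u b := fun w => by
      simp [koszulForm, Fintype.linearCombination_apply]
    refine ⟨fun b => GradedAlgebra.proj 𝒜 (i - d b) (v b), ?_, ?_⟩
    · exact (hR.proj_mem _ _).1 (by omega)
    · rw [← proj_eq_self hx, hsum, hsum, map_sum]
      refine Finset.sum_congr rfl fun b _ => ?_
      have h2 := DirectSum.coe_decompose_mul_add_of_right_mem 𝒜 (i := i - d b) (a := v b) (h.mem b)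
      rw [sub_add_cancel] at h2
      rw [GradedAlgebra.proj_apply, GradedAlgebra.proj_apply, h2]
  have h2 : u a ∈ I := by
    rw [← h.range_eq]
    exact ⟨Pi.single a 1, by simp [koszulForm, Fintype.linearCombination_apply_single]⟩
  obtain ⟨v, hv, hva⟩ := h1 h2
  have h3 : Pi.single a 1 - v ∈ LinearMap.ker (koszulForm u) := by
    rw [LinearMap.mem_ker, map_sub, hva]
    simp [koszulForm, Fintype.linearCombination_apply_single]
  have h4 : ∀ w ∈ maxIdeal 𝒜 • (⊤ : Submodule R (Fin n → R)), w a ∈ maxIdeal 𝒜 := by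
    intro w hw
    refine Submodule.smul_induction_on hw (fun r hr x _ => ?_) fun x y hx hy => add_mem hx hy
    exact Ideal.mul_mem_right _ _ hr
  have h5 := h4 _ (h.ker_le h3)
  have hv0 : v a = 0 := hv
  rw [Pi.sub_apply, Pi.single_eq_same, hv0, sub_zero] at h5
  exact hR.maxIdeal_ne_top ((Ideal.eq_top_iff_one _).2 h5)

end Bound

/-! ### Existence of c -/

section Existence

variable {K : Type w} {R : Type u} [Field K] [CommRing R] [Algebra K R]
  {𝒜 : ℤ → Submodule K R} [GradedAlgebra 𝒜] {M : Type v} [AddCommGroup M] [Module R M]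

theorem IsStandardGraded.isNoetherianRing (hR : IsStandardGraded 𝒜) : IsNoetherianRing R := by
  have : Module.Finite K (𝒜 1) := hR.finite_one
  have hft : Algebra.FiniteType K R := by
    obtain ⟨s, hs⟩ := Module.Finite.iff_fg.1 hR.finite_one
    refine ⟨s, eq_top_iff.2 ?_⟩
    rw [← hR.adjoin_one]
    refine Algebra.adjoin_le fun x hx => ?_
    rw [← hs] at hx
    exact Algebra.span_le_adjoin K _ hx
  exact Algebra.FiniteType.isNoetherianRing K R

/-- A proper homogeneous ideal lies in `𝔪`. -/
theorem IsStandardGraded.le_maxIdeal (hR : IsStandardGraded 𝒜) {J : Ideal R}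
    (hJ : J.IsHomogeneous 𝒜) (hne : J ≠ ⊤) : J ≤ maxIdeal 𝒜 := by
  classical
  intro x hx
  rw [← DirectSum.sum_support_decompose 𝒜 x]
  refine Ideal.sum_mem _ fun i _ => ?_
  rcases eq_or_ne i 0 with rfl | hi
  · have h1 : (DirectSum.decompose 𝒜 x 0 : R) ∈ J := hJ 0 hx
    obtain ⟨k, hk⟩ := hR.exists_algebraMap (DirectSum.decompose 𝒜 x 0).2
    rw [← hk] at h1 ⊢
    rcases eq_or_ne k 0 with rfl | hk0
    · rw [map_zero]; exact zero_mem _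
    · exact absurd (J.eq_top_of_isUnit_mem h1 ((IsUnit.mk0 k hk0).map _)) hne
  · exact hR.mem_maxIdeal_of_ne hi (DirectSum.decompose 𝒜 x i).2

/-- For x of degree j, the component of r x in degree i + j is r_i x, so r x = 0 kills each r_i x;
homogeneous x suffice. -/
theorem isHomogeneous_annihilator [Module K M] [IsScalarTower K R M] (ℳ : ℤ → Submodule K M)
    [DirectSum.Decomposition ℳ] (hsmul : ∀ i j r x, r ∈ 𝒜 i → x ∈ ℳ j → r • x ∈ ℳ (i + j)) :
    (Module.annihilator R M).IsHomogeneous 𝒜 := by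
  classical
  intro i r hr
  rw [Module.mem_annihilator] at hr ⊢
  intro x
  induction x using DirectSum.Decomposition.inductionOn ℳ with
  | zero => rw [smul_zero]
  | @homogeneous j x =>
    have h1 : ∀ s : R, (DirectSum.decompose ℳ (s • (x : M)) (i + j) : M) =
        (DirectSum.decompose 𝒜 s i : R) • (x : M) := by
      intro s
      induction s using DirectSum.Decomposition.inductionOn 𝒜 with
      | zero => simp
      | @homogeneous k s =>
        have h2 := hsmul k j s x s.2 x.2
        by_cases hki : k = i
        · subst hki
          rw [DirectSum.decompose_of_mem_same ℳ h2, DirectSum.decompose_of_mem_same 𝒜 s.2]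
        · rw [DirectSum.decompose_of_mem_ne ℳ h2 (fun h => hki (by omega)),
            DirectSum.decompose_of_mem_ne 𝒜 s.2 hki, zero_smul]
      | add s t hs ht =>
        rw [add_smul, DirectSum.decompose_add, DirectSum.decompose_add, DirectSum.add_apply,
          DirectSum.add_apply, Submodule.coe_add, Submodule.coe_add, hs, ht, add_smul]
    rw [← h1 r, hr, DirectSum.decompose_zero]
    rfl
  | add x y hx hy => rw [smul_add, hx, hy, add_zero]

/-- The radical of a homogeneous ideal is the intersection of the homogeneous primes above it; each
is maximal and contained in 𝔪, hence equal to 𝔪. -/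
theorem IsStandardGraded.maxIdeal_le_radical [Nontrivial R] (hR : IsStandardGraded 𝒜) {J : Ideal R}
    (hJ : J.IsHomogeneous 𝒜) (hmax : ∀ p : Ideal R, p.IsPrime → J ≤ p → p.IsMaximal) :
    maxIdeal 𝒜 ≤ J.radical := by
  rw [hJ.radical_eq]
  refine le_sInf ?_
  rintro p ⟨hp, hJp, hprime⟩
  exact ((hmax p hprime hJp).eq_of_le hR.maxIdeal_ne_top
    (hR.le_maxIdeal hp hprime.ne_top)).ge

/-- The support of M/IM is V(I + Ann M), and dimension 0 makes the minimal primes of its annihilator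
maximal. -/
theorem isMaximal_of_supportDim_eq_zero [Module.Finite R M] {I : Ideal R}
    (hdim : Module.supportDim R (M ⧸ (I • ⊤ : Submodule R M)) = 0) (p : Ideal R) (hp : p.IsPrime)
    (hIp : I ⊔ Module.annihilator R M ≤ p) : p.IsMaximal := by
  rw [Module.supportDim_eq_ringKrullDim_quotient_annihilator] at hdim
  have h0 : Ring.KrullDimLE 0 (R ⧸ Module.annihilator R (M ⧸ (I • ⊤ : Submodule R M))) :=
    (Order.krullDimLE_iff _ _).2 hdim.le
  rw [Ideal.krullDimLE_zero_quotient_iff_forall_minimalPrimes_isMaximal] at h0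
  have hsupp : (⟨p, hp⟩ : PrimeSpectrum R) ∈
      Module.support R (M ⧸ (I • ⊤ : Submodule R M)) := by
    rw [Module.support_quotient, Module.support_eq_zeroLocus]
    exact ⟨le_sup_right.trans hIp, le_sup_left.trans hIp⟩
  rw [Module.support_eq_zeroLocus] at hsupp
  obtain ⟨q, hq, hqp⟩ := Ideal.exists_minimalPrimes_le
    (show Module.annihilator R (M ⧸ (I • ⊤ : Submodule R M)) ≤ p from hsupp)
  rw [← (h0 q hq).eq_of_le hp.ne_top hqp]
  exact h0 q hq

theorem exists_generatedInDegreeLE [IsNoetherianRing R] {I : Ideal R} (hI : I.IsHomogeneous 𝒜) :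
    ∃ c₀ : ℕ, ∀ c : ℕ, c₀ ≤ c → GeneratedInDegreeLE 𝒜 I c := by
  classical
  let f : ℕ →o Ideal R :=
    ⟨fun c => Ideal.span {x | x ∈ I ∧ ∃ i : ℤ, i ≤ c ∧ x ∈ 𝒜 i}, fun a b hab =>
      Ideal.span_mono fun x ⟨hx, i, hi, hxi⟩ => ⟨hx, i, hi.trans (by exact_mod_cast hab), hxi⟩⟩
  -- The ideals generated by the elements of I of degree ≤ c form an ascending chain, stationary
  -- from c₀ on, and each component of an element of I lies in one of them.
  obtain ⟨c₀, hc₀⟩ := monotone_stabilizes_iff_noetherian.2 ‹IsNoetherianRing R› f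
  refine ⟨c₀, fun c hc => le_antisymm (fun x hx => ?_) (Ideal.span_le.2 fun x hx => hx.1)⟩
  rw [← DirectSum.sum_support_decompose 𝒜 x]
  refine Ideal.sum_mem _ fun i _ => ?_
  have h1 : (DirectSum.decompose 𝒜 x i : R) ∈ f (max c i.toNat) :=
    Ideal.subset_span ⟨hI i hx, i, by push_cast; omega, (DirectSum.decompose 𝒜 x i).2⟩
  rwa [← hc₀ _ (hc.trans (le_max_left _ _)), hc₀ c hc] at h1

end Existence

end KoszulReg

end

/-! ### The theorem -/

open KoszulReg in
theorem proposition3p2 {K : Type*} {R : Type*} {M : Type*} [Field K] [CommRing R] [Algebra K R]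
    (𝒜 : ℤ → Submodule K R) [GradedAlgebra 𝒜] (hR : IsStandardGraded 𝒜) (hK : IsKoszul 𝒜)
    [AddCommGroup M] [Module R M] [Module K M] [IsScalarTower K R M] [Module.Finite R M]
    (ℳ : ℤ → Submodule K M) [DirectSum.Decomposition ℳ] [SetLike.GradedSMul 𝒜 ℳ]
    (I : Ideal R) (hI : I.IsHomogeneous 𝒜)
    (hdim : Module.supportDim R (M ⧸ (I • ⊤ : Submodule R M)) = 0) :
    ∃ c : ℕ,
      IsLeast {c : ℕ | maxIdeal 𝒜 ^ c ≤ I ⊔ Module.annihilator R M ∧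
        GeneratedInDegreeLE 𝒜 I c} c ∧
      ∀ (n : ℕ) (u : Fin n → R) (d : Fin n → ℤ), IsMinimalPresentation 𝒜 I u d →
        ∀ t : ℕ,
          regularity 𝒜 (cyclesGrading u d ℳ t) ≤
            (t : EReal) * ((c : EReal) + 1) + regularity 𝒜 ℳ ∧
          regularity 𝒜 (homologyGrading u d ℳ t) ≤
            (t : EReal) * ((c : EReal) + 1) + regularity 𝒜 ℳ + (c : EReal) - 1 := by
  have hsmul : ∀ i j r x, r ∈ 𝒜 i → x ∈ ℳ j → r • x ∈ ℳ (i + j) :=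
    fun i j r x hr hx => SetLike.GradedSMul.smul_mem hr hx
  -- Over the zero ring M/IM would vanish and have dimension -∞ rather than 0.
  have hnt : Nontrivial R := by
    by_contra hR0
    rw [not_nontrivial_iff_subsingleton] at hR0
    have := Module.subsingleton R (M ⧸ (I • ⊤ : Submodule R M))
    rw [Module.supportDim_eq_bot_of_subsingleton] at hdim
    exact absurd hdim (by decide)
  have hK' : RegularityLE 𝒜 (residueGrading 𝒜) 0 := by
    rw [← regularity_le_intCast_iff, show regularity 𝒜 (residueGrading 𝒜) = 0 from hK]
    simp
  have := hR.isNoetherianRing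
  have hne : {c : ℕ | maxIdeal 𝒜 ^ c ≤ I ⊔ Module.annihilator R M ∧
      GeneratedInDegreeLE 𝒜 I c}.Nonempty := by
    obtain ⟨a, ha⟩ := Ideal.exists_pow_le_of_le_radical_of_fg_radical
      (hR.maxIdeal_le_radical (hI.sup (isHomogeneous_annihilator ℳ hsmul))
        (isMaximal_of_supportDim_eq_zero hdim)) (IsNoetherian.noetherian _)
    obtain ⟨b, hb⟩ := exists_generatedInDegreeLE hI
    exact ⟨max a b, (Ideal.pow_le_pow_right (le_max_left a b)).trans ha, hb _ (le_max_right a b)⟩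
  refine ⟨_, ⟨Nat.sInf_mem hne, fun _ h => Nat.sInf_le h⟩, fun n u d hu t => ?_⟩
  obtain ⟨hc, hgen⟩ := Nat.sInf_mem hne
  generalize sInf {c : ℕ | maxIdeal 𝒜 ^ c ≤ I ⊔ Module.annihilator R M ∧
    GeneratedInDegreeLE 𝒜 I c} = c at hc hgen ⊢
  have hd := degree_le_of_isMinimalPresentation hR hu hgen
  rw [← hu.range_eq] at hc
  have hZ : ∀ r, RegularityLE 𝒜 ℳ r → RegularityLE 𝒜 (cyclesGrading u d ℳ t) (t * (c + 1) + r) :=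
    fun r hr => regularityLE_cycles hR hK' hsmul hu.mem hd hc hr t
  constructor
  · refine (regularity_le_add_of_forall (𝒩 := ℳ) _ hZ).trans_eq ?_
    push_cast
    rfl
  -- All finite terms are gathered into one integral shift, so that only reg M, possibly infinite,
  -- remains apart.
  · refine (regularity_le_add_of_forall (𝒩 := ℳ) (t * (c + 1) + c - 1) fun r hr => ?_).trans_eq ?_
    · have h := regularityLE_homology hR hK' hsmul hc (hZ r hr)
      rwa [show (t * (c + 1) + r + c - 1 : ℤ) = t * (c + 1) + c - 1 + r by ring] at h
    · push_cast
      rw [sub_eq_add_neg, sub_eq_add_neg]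
      ac_rfl
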